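/- Consider the Edwards--Anderson Ising spin glass on the square lattice $\mathbb Z^2$ (nearest-neighbour edges). Let the couplings $J=(J_{xy})_{\langle x,y\rangle}$ be i.i.d. real random variables whose common law is symmetric, has no atoms, and has support equal to all of $\mathbb R$. For $\sigma\in\{\pm1\}^{\mathbb Z^2}$ the value of the edge $\langle x,y\rangle$ is $J_{xy}\sigma_x\sigma_y$, and the edge, together with its dual edge, is called unsatisfied if its value is negative. A ground state for $J$ is a configuration $\sigma$ whose energy, formally $-\sum_{\langle x,y\rangle}J_{xy}\sigma_x\sigma_y$, cannot be lowered by flipping finitely many spins; equivalently, $\sum_{\langle x,y\rangle\in\partial C}J_{xy}\sigma_x\sigma_y\ge 0$ for every finite $C\subset\mathbb Z^2$, where $\partial C$ is the set of edges with exactly one endpoint in $C$. If $\sigma$ is a ground state, so is $-\sigma$, and $\{\sigma,-\sigma\}$ is called a ground-state pair for $J$. Let $\mu$ be a probability measure on pairs $(J,\{\sigma,-\sigma\})$ that is invariant under all simultaneous translations of couplings and spins by vectors of $\mathbb Z^2$, whose marginal on $J$ is the above i.i.d. law, and under which $\{\sigma,-\sigma\}$ is almost surely a ground-state pair for $J$.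 Let $\mathfrak F$ be the subgraph of the dual lattice $\mathbb Z^2+(\tfrac12,\tfrac12)$ formed by the unsatisfied dual edges. Then, $\mu$-almost surely, $\mathfrak F$ is a forest and all its connected components are finite; that is, the unsatisfied dual edges do not percolate. -/

import Mathlib

namespace SpinGlass

/-- Sites of the square lattice. -/
abbrev Site : Type := ℤ × ℤ

/-- Nearest-neighbour edges of the square lattice, each listed once, by its left or lower endpoint
and its direction: `(v, false)` is the horizontal edge `{v, v + (1, 0)}` and
`(v, true)` is the vertical edge `{v, v + (0, 1)}`. -/
abbrev Edge : Type := Site × Bool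

/-- The unit step in a direction (`false` horizontal, `true` vertical). -/
def step : Bool → Site
  | false => (1, 0)
  | true => (0, 1)

/-- The left or lower endpoint of an edge. -/
def Edge.src (e : Edge) : Site := e.1

/-- The right or upper endpoint of an edge. -/
def Edge.tgt (e : Edge) : Site := e.1 + step e.2

/-- Realizations of the couplings: a real number for every edge. -/
abbrev Coupling : Type := Edge → ℝ

/-- Spin configurations: a spin `1` or `-1` at every site. -/
abbrev Spin : Type := Site → ℤˣ

/-- The value `J_{xy} σ_x σ_y` of the edge `e = {x, y}`. -/
def edgeValue (J : Coupling) (σ : Spin) (e : Edge) : ℝ :=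
  J e * ((σ e.src : ℤ) : ℝ) * ((σ e.tgt : ℤ) : ℝ)

/-- The boundary of a finite set of sites: the edges with exactly one endpoint in it
(see `mem_edgeBoundary`). -/
def edgeBoundary (C : Finset Site) : Finset Edge :=
  (C ×ˢ Finset.univ ∪ (C ×ˢ Finset.univ).image fun e : Edge => (e.1 - step e.2, e.2)).filter
    fun e => ¬(Edge.src e ∈ C ↔ Edge.tgt e ∈ C)

theorem mem_edgeBoundary (C : Finset Site) (e : Edge) :
    e ∈ edgeBoundary C ↔ (e.src ∈ C ∧ e.tgt ∉ C) ∨ (e.src ∉ C ∧ e.tgt ∈ C) := by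
  unfold edgeBoundary
  rw [Finset.mem_filter]
  constructor
  · rintro ⟨-, h⟩
    tauto
  · intro h
    refine ⟨?_, by tauto⟩
    rcases h with ⟨h, -⟩ | ⟨-, h⟩
    · exact Finset.mem_union_left _ (Finset.mem_product.2 ⟨h, Finset.mem_univ _⟩)
    · refine Finset.mem_union_right _ (Finset.mem_image.2 ⟨(e.tgt, e.2), ?_, ?_⟩)
      · exact Finset.mem_product.2 ⟨h, Finset.mem_univ _⟩
      · simp [Edge.tgt]

/-- `σ` is a ground state for `J`: no flip of finitely many spins lowers the energy
`- ∑ J_{xy} σ_x σ_y`. Flipping the spins in `C` changes the energy by twice the sum of the values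
of the boundary edges of `C`. -/
def IsGroundState (J : Coupling) (σ : Spin) : Prop :=
  ∀ C : Finset Site, 0 ≤ ∑ e ∈ edgeBoundary C, edgeValue J σ e

/-- Two spin configurations are identified if they agree up to a global flip. -/
instance flipSetoid : Setoid Spin where
  r σ τ := τ = σ ∨ τ = -σ
  iseqv :=
    { refl := fun _ => Or.inl rfl
      symm := by
        rintro σ τ (rfl | rfl)
        · exact Or.inl rfl
        · exact Or.inr (neg_neg σ).symm
      trans := by
        rintro σ τ υ (rfl | rfl) (rfl | rfl)
        · exact Or.inl rfl
        · exact Or.inr rfl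
        · exact Or.inr rfl
        · exact Or.inl (neg_neg σ) }

/-- Pairs `{σ, -σ}` of spin configurations, with the quotient σ-algebra of the product
σ-algebra on spin configurations. -/
abbrev SpinPair : Type := Quotient flipSetoid

theorem edgeValue_neg (J : Coupling) (σ : Spin) (e : Edge) :
    edgeValue J (-σ) e = edgeValue J σ e := by
  simp [edgeValue]

theorem edgeValue_congr (J : Coupling) (e : Edge) (σ τ : Spin) (h : σ ≈ τ) :
    edgeValue J σ e = edgeValue J τ e := by
  rcases h with rfl | rfl
  · rfl
  · exact (edgeValue_neg J σ e).symm

/-- The value of an edge under a pair `{σ, -σ}` (it is the same for `σ` and `-σ`). -/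
def pairValue (J : Coupling) (p : SpinPair) (e : Edge) : ℝ :=
  Quotient.lift (fun σ => edgeValue J σ e) (edgeValue_congr J e) p

/-- `p = {σ, -σ}` is a ground-state pair for `J`: its members are ground states. -/
def IsGroundStatePair (J : Coupling) (p : SpinPair) : Prop :=
  ∀ σ : Spin, ⟦σ⟧ = p → IsGroundState J σ

/-- Translation of couplings by `z`. -/
def translateCoupling (z : Site) (J : Coupling) : Coupling := fun e => J (e.1 - z, e.2)

/-- Translation of spin configurations by `z`. -/
def translateSpin (z : Site) (σ : Spin) : Spin := fun x => σ (x - z)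

/-- Translation of pairs `{σ, -σ}` by `z`. -/
def translatePair (z : Site) : SpinPair → SpinPair :=
  Quotient.map (translateSpin z) (by
    rintro σ τ (rfl | rfl)
    · exact Or.inl rfl
    · exact Or.inr rfl)

/-- Simultaneous translation of couplings and pairs by `z`. -/
def translateJoint (z : Site) (x : Coupling × SpinPair) : Coupling × SpinPair :=
  (translateCoupling z x.1, translatePair z x.2)

/-- Vertices of the dual lattice `ℤ² + (1/2, 1/2)`: `f` stands for the point `f + (1/2, 1/2)`,
the centre of the unit square with lower left corner `f`. -/
abbrev DualSite : Type := ℤ × ℤ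

/-- The two endpoints of the dual edge `e*`, which are the unit squares on the two sides of `e`:
those with lower left corners `v` and `v - (0, 1)` if `e = {v, v + (1, 0)}`, and
`v` and `v - (1, 0)` if `e = {v, v + (0, 1)}`. -/
def dualEnds (e : Edge) : Sym2 DualSite := s(e.1, e.1 - step (!e.2))

/-- The graph on the dual lattice formed by the duals of the unsatisfied edges,
that is, of the edges of negative value. -/
def unsatDual (J : Coupling) (p : SpinPair) : SimpleGraph DualSite where
  Adj f g := ∃ e : Edge, pairValue J p e < 0 ∧ dualEnds e = s(f, g)
  symm := ⟨by
    rintro f g ⟨e, he, h⟩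
    exact ⟨e, he, h.trans Sym2.eq_swap⟩⟩
  loopless := ⟨by
    rintro f ⟨⟨v, d⟩, -, h⟩
    cases d <;> simp [dualEnds, step, Prod.ext_iff] at h <;> grind⟩

end SpinGlass

/-!
The theorem is a statement about the edge values `v e = J_{xy} σ_x σ_y` alone. Their law is
translation invariant, the absolute values `|v e| = |J e|` are independent with a common law that
has no atom at `0`, and `v` satisfies the cut inequality `0 ≤ ∑ e ∈ ∂C, v e` for all finite `C`
(`ValueLaw`). Write `F` for the graph of the dual edges with `v e < 0`.

A chain modulo two of dual edges without boundary is the boundary of a finite set of sites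
(`exists_edgeBoundary`), by the Poincaré lemma on a box. So a cycle in `F` would be a cut of negative
total value, and `F` is a forest (`CutNonneg.isAcyclic`).

Two tools are used to compare energies. A box of radius `m` can be enclosed by a contour of total
weight `O(m)`, although the couplings need not have any moment: add to the box the clusters of
heavy edges touching it (`real_not_enclosed_le`). And a path of `k` dual edges has weight at least
a constant times `k`, by a union bound over paths (`real_exists_light_le`).

*Infinite components are unique.* Otherwise, by translation invariance, a box of radius `n`
contains `≈ n²` well separated places where two infinite components come close. Join them there by
a short chain; together with paths to infinity in the two components this is a cut on the scale of
the box. The sum modulo two of a uniformly random subfamily of these cuts uses each of the edges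
involved with probability one half, so on average the energy gained is a large multiple of the number
of places, whereas the contour enclosing the box costs only `O(n)`
(`CutNonneg.card_mul_le`, `ValueLaw.real_twoInf_eq_zero`). No ergodic theorem is needed, only
expectations.

*A unique infinite component is impossible.* A path in `F` between two dual sites in a block of
radius `m` cannot go farther than a constant times `m`: flipping the spins between the path and a
short-cut in the block, but outside of the contour enclosing the block, would lower the energy
(`CutNonneg.mem_box_of_enclosed`). Take a ring of `≈ λ` blocks of radius `m` around the origin, at
distance `≈ λ m`. If `m` is large, an infinite component meets all of these blocks, and the paths
between neighbouring blocks form a closed walk in `F` around the origin, which a forest does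
not admit (`not_surrounded`). A block may be badly enclosed, but on the scale `λ m` this
has probability `O(λ⁻²)` by a second moment bound, so the total failure probability is `O(λ⁻¹)`
(`ValueLaw.ae_forall_not_infComp`).
-/

namespace SpinGlass

open MeasureTheory

/-! ### Boxes and chains modulo two -/

/-- The sites at sup-norm distance at most `r` from `z`; also used for dual sites. -/
noncomputable def box (z : Site) (r : ℕ) : Finset Site :=
  Finset.Icc (z.1 - r) (z.1 + r) ×ˢ Finset.Icc (z.2 - r) (z.2 + r)

theorem mem_box {z x : Site} {r : ℕ} :
    x ∈ box z r ↔ (z.1 - r ≤ x.1 ∧ x.1 ≤ z.1 + r) ∧ (z.2 - r ≤ x.2 ∧ x.2 ≤ z.2 + r) := by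
  simp [box]

theorem card_box (z : Site) (r : ℕ) : (box z r).card = (2 * r + 1) ^ 2 := by
  have h : ∀ a : ℤ, (a + r + 1 - (a - r)).toNat = 2 * r + 1 := by intro a; omega
  simp [box, h, sq]

/-- The divergence at the dual site `f` of a chain of dual edges modulo two: the sum over the four
dual edges at `f`, that is, over the four sides of the unit square with centre `f`. -/
def div (X : Edge → ZMod 2) (f : DualSite) : ZMod 2 :=
  X (f, false) + X (f + (0, 1), false) + X (f, true) + X (f + (1, 0), true)

theorem div_add (X Y : Edge → ZMod 2) (f : DualSite) : div (X + Y) f = div X f + div Y f := by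
  simp only [div, Pi.add_apply]; ring

theorem div_sum {ι : Type*} (s : Finset ι) (X : ι → Edge → ZMod 2) (f : DualSite) :
    div (∑ i ∈ s, X i) f = ∑ i ∈ s, div (X i) f := by
  simp only [div, Finset.sum_apply, Finset.sum_add_distrib]

/-- The chain consisting of one dual edge has its endpoints as boundary. -/
theorem div_single (e : Edge) (f : DualSite) :
    div (Pi.single e 1) f
      = (if f = e.1 then 1 else 0) + (if f = e.1 - step (!e.2) then 1 else 0) := by
  obtain ⟨⟨a, b⟩, d⟩ := e
  obtain ⟨x, y⟩ := f
  cases d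
  · have h1 : ((x, y + 1) : ℤ × ℤ) = (a, b) ↔ (x, y) = (a, b - 1) := by
      simp only [Prod.mk.injEq]; omega
    simp [div, Pi.single_apply, step, h1]
  · have h1 : ((x + 1, y) : ℤ × ℤ) = (a, b) ↔ (x, y) = (a - 1, b) := by
      simp only [Prod.mk.injEq]; omega
    simp [div, Pi.single_apply, step, h1]

theorem dualEnds_injective : Function.Injective dualEnds := by
  rintro ⟨⟨a, b⟩, d⟩ ⟨⟨a', b'⟩, d'⟩ h
  cases d <;> cases d' <;> simp [dualEnds, step] at h ⊢ <;> omega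

/-- The potential of a chain of dual edges, based at `(-R, -R)`: the sum of the chain along the
path that first goes up and then to the right. -/
noncomputable def potential (R : ℤ) (X : Edge → ZMod 2) (x : Site) : ZMod 2 :=
  ∑ j ∈ Finset.Ico (-R) x.2, X ((-R, j), true) + ∑ i ∈ Finset.Ico (-R) x.1, X ((i, x.2), false)

theorem sum_Ico_succ_right {a b : ℤ} (h : a ≤ b) (f : ℤ → ZMod 2) :
    ∑ i ∈ Finset.Ico a (b + 1), f i = ∑ i ∈ Finset.Ico a b, f i + f b := by
  have h2 : Finset.Ico a (b + 1) = insert b (Finset.Ico a b) := by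
    ext x; simp; omega
  rw [h2, Finset.sum_insert (by simp), add_comm]

theorem potential_right {R : ℤ} (X : Edge → ZMod 2) {x : Site} (h : -R ≤ x.1) :
    potential R X (x + (1, 0)) = potential R X x + X (x, false) := by
  simp [potential, sum_Ico_succ_right h, add_assoc]

/-- A chain without boundary in a box is the gradient of its potential there. -/
theorem potential_up {R : ℤ} (X : Edge → ZMod 2)
    (hX : ∀ f : DualSite, -R ≤ f.1 → f.1 < R → -R ≤ f.2 → f.2 < R → div X f = 0)
    {x : Site} (h1 : -R ≤ x.1) (h1' : x.1 ≤ R) (h2 : -R ≤ x.2) (h2' : x.2 < R) :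
    potential R X (x + (0, 1)) = potential R X x + X (x, true) := by
  obtain ⟨a, b⟩ := x
  simp only at h1 h1' h2 h2'
  induction a, h1 using Int.leInduction with
  | base => simp [potential, sum_Ico_succ_right h2]
  | succ a ha ih =>
    have ih := ih (by omega)
    have e1 := potential_right X (x := (a, b)) ha
    have e2 := potential_right X (x := (a, b + 1)) ha
    have hd := hX (a, b) ha (by simp only; omega) h2 h2'
    simp only [Prod.mk_add_mk, add_zero, div] at ih e1 e2 hd ⊢
    rw [e2, e1, ih]
    have h3 : ∀ p q r s t : ZMod 2, p + q + r + s = 0 → t + r + q = t + p + s := by decide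
    exact h3 _ _ _ _ _ hd

theorem potential_grad {R : ℕ} (X : Edge → ZMod 2)
    (hX : ∀ f ∈ box 0 R, div X f = 0) (e : Edge)
    (hs : e.src ∈ box 0 R) (ht : e.tgt ∈ box 0 R) :
    potential R X e.tgt = potential R X e.src + X e := by
  obtain ⟨x, d⟩ := e
  simp only [mem_box, Edge.src, Edge.tgt, Prod.fst_add, Prod.snd_add, Prod.fst_zero,
    Prod.snd_zero] at hs ht ⊢
  cases d
  · exact potential_right X (by omega)
  · refine potential_up X (fun f h1 h2 h3 h4 => hX f ?_) (by omega) (by omega) (by omega) ?_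
    · rw [mem_box]; simp; omega
    · simp only [step] at ht; omega

/-- A finite chain of dual edges without boundary is the boundary of a finite set of sites. -/
theorem exists_edgeBoundary (X : Edge → ZMod 2) (r : ℕ) (hr : ∀ e, X e ≠ 0 → e.1 ∈ box 0 r)
    (hX : ∀ f, div X f = 0) :
    ∃ C : Finset Site, ∀ e, e ∈ edgeBoundary C ↔ X e = 1 := by
  set R : ℕ := r + 2 with hR
  have hz : ∀ e : Edge, e.1 ∉ box 0 r → X e = 0 := fun e he => by
    by_contra h; exact he (hr e h)
  have hgr := potential_grad (R := R) X (fun f _ => hX f)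
  -- The potential vanishes on the outermost layer of the box.
  have hring : ∀ x ∈ box 0 R, x ∉ box 0 (r + 1) → potential R X x = 0 := by
    rintro ⟨a, b⟩ hx hx'
    simp only [mem_box, Prod.fst_zero, Prod.snd_zero] at hx hx'
    have hleft : ∑ j ∈ Finset.Ico (-(R : ℤ)) b, X ((-(R : ℤ), j), true) = 0 :=
      Finset.sum_eq_zero fun j _ => hz _ (by simp [mem_box]; omega)
    have hrow : ∀ c : ℤ, (c < -(r : ℤ) ∨ (r : ℤ) < c) → ∀ a : ℤ, -(R : ℤ) ≤ a → a ≤ R →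
        -(R : ℤ) ≤ c → c ≤ R → potential R X (a, c) = 0 := by
      intro c hc a _ _ _ _
      unfold potential
      rw [Finset.sum_eq_zero fun j _ => hz _ (by simp [mem_box]; omega),
        Finset.sum_eq_zero fun j _ => hz _ (by simp [mem_box]; omega), add_zero]
    by_cases h1 : b < -(r : ℤ) ∨ (r : ℤ) < b
    · exact hrow b h1 a (by omega) (by omega) (by omega) (by omega)
    · have ha : a = -(R : ℤ) ∨ a = R := by omega
      rcases ha with rfl | rfl
      · unfold potential
        rw [hleft]; simp
      · have key : ∀ c : ℤ, -(R : ℤ) ≤ c → c ≤ R → potential R X ((R : ℤ), c) = 0 := by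
          intro c hc
          induction c, hc using Int.leInduction with
          | base => intro _; exact hrow _ (by omega) _ (by omega) le_rfl le_rfl (by omega)
          | succ c hc ih =>
            intro hc'
            have := hgr (((R : ℤ), c), true) (by simp [mem_box, Edge.src]; omega)
              (by simp [mem_box, Edge.tgt, step]; omega)
            rw [hz _ (by simp [mem_box]; omega)] at this
            simp only [Edge.src, Edge.tgt, step, Prod.mk_add_mk, add_zero] at this
            rw [this, ih (by omega)]
        exact key b (by omega) (by omega)
  have h01 : ∀ t : ZMod 2, t = 0 ∨ t = 1 := by decide
  refine ⟨(box 0 R).filter fun x => potential R X x = 1, fun e => ?_⟩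
  rw [mem_edgeBoundary]
  simp only [Finset.mem_filter]
  by_cases hs : e.src ∈ box 0 R
  · by_cases ht : e.tgt ∈ box 0 R
    · simp only [hs, ht, true_and, hgr e hs ht]
      have : ∀ p q : ZMod 2, p = 1 ∧ ¬ p + q = 1 ∨ ¬ p = 1 ∧ p + q = 1 ↔ q = 1 := by decide
      exact this _ _
    · have h1 : e.src ∉ box 0 (r + 1) := by
        intro h; apply ht
        obtain ⟨⟨a, b⟩, d⟩ := e
        cases d <;> simp [mem_box, Edge.src, Edge.tgt, step] at h ⊢ <;> omega
      have h2 : X e = 0 := hz _ (by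
        intro h; apply h1
        simp only [mem_box, Edge.src] at h ⊢; omega)
      simp [ht, hring _ hs h1, h2]
  · have h2 : X e = 0 := hz _ (by
        intro h; apply hs
        simp only [mem_box, Edge.src] at h ⊢; omega)
    by_cases ht : e.tgt ∈ box 0 R
    · have h1 : e.tgt ∉ box 0 (r + 1) := by
        intro h; apply hs
        obtain ⟨⟨a, b⟩, d⟩ := e
        cases d <;> simp [mem_box, Edge.src, Edge.tgt, step] at h ⊢ <;> omega
      simp [hs, hring _ ht h1, h2]
    · simp [hs, ht, h2]

/-! ### Chains carried by walks, and the energy inequality -/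

/-- The graph on the dual lattice formed by the dual edges on which `v` is negative. -/
def unsat (v : Edge → ℝ) : SimpleGraph DualSite where
  Adj f g := ∃ e : Edge, v e < 0 ∧ dualEnds e = s(f, g)
  symm := ⟨by
    rintro f g ⟨e, he, h⟩
    exact ⟨e, he, h.trans Sym2.eq_swap⟩⟩
  loopless := ⟨by
    rintro f ⟨⟨v, d⟩, -, h⟩
    cases d <;> simp [dualEnds, step, Prod.ext_iff] at h <;> grind⟩

/-- The cut inequality: the sum of `v` over the boundary of a finite set of sites is
nonnegative. A configuration is a ground state if its edge values have this property. -/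
def CutNonneg (v : Edge → ℝ) : Prop :=
  ∀ C : Finset Site, 0 ≤ ∑ e ∈ edgeBoundary C, v e

/-- The chain modulo two of a walk on the dual lattice: how often it uses each dual edge. -/
def walkChain {G : SimpleGraph DualSite} {f g : DualSite} (p : G.Walk f g) : Edge → ZMod 2 :=
  fun e => (p.edges.count (dualEnds e) : ZMod 2)

theorem div_walkChain {v : Edge → ℝ} {f g : DualSite} (p : (unsat v).Walk f g) (h : DualSite) :
    div (walkChain p) h = (if h = f then 1 else 0) + (if h = g then 1 else 0) := by
  induction p with
  | nil =>
    simp only [div, walkChain, SimpleGraph.Walk.edges_nil, List.count_nil, Nat.cast_zero]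
    split_ifs <;> decide
  | @cons f k g hadj p ih =>
    obtain ⟨e, -, he⟩ := id hadj
    have hc : walkChain (SimpleGraph.Walk.cons hadj p) = walkChain p + Pi.single e 1 := by
      ext e'
      simp only [walkChain, SimpleGraph.Walk.edges_cons, List.count_cons, Pi.add_apply,
        Nat.cast_add, Pi.single_apply, ← he, beq_iff_eq, dualEnds_injective.eq_iff]
      congr 1
      simp [eq_comm]
    rw [hc, div_add, ih, div_single]
    have hfk : (if h = e.1 then (1 : ZMod 2) else 0) + (if h = e.1 - step (!e.2) then 1 else 0)
        = (if h = f then 1 else 0) + (if h = k then 1 else 0) := by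
      simp only [dualEnds, Sym2.eq_iff] at he
      rcases he with ⟨h1, h2⟩ | ⟨h1, h2⟩
      · rw [h2, h1]
      · rw [h2, h1, add_comm]
    rw [hfk]
    have : ∀ a b c : ZMod 2, a + b + (c + a) = c + b := by decide
    exact this _ _ _

theorem walkChain_eq_one_iff {v : Edge → ℝ} {f g : DualSite} {p : (unsat v).Walk f g}
    (hp : p.edges.Nodup) (e : Edge) : walkChain p e = 1 ↔ dualEnds e ∈ p.edges := by
  unfold walkChain
  by_cases h : dualEnds e ∈ p.edges
  · simp [h, List.count_eq_one_of_mem hp h]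
  · simp [h, List.count_eq_zero_of_not_mem h]

theorem walkChain_eq_zero {v : Edge → ℝ} {f g : DualSite} {p : (unsat v).Walk f g}
    {e : Edge} (h : dualEnds e ∉ p.edges) : walkChain p e = 0 := by
  simp [walkChain, List.count_eq_zero_of_not_mem h]

theorem neg_of_mem_edges {v : Edge → ℝ} {f g : DualSite} {p : (unsat v).Walk f g} {e : Edge}
    (h : dualEnds e ∈ p.edges) : v e < 0 := by
  have := p.edges_subset_edgeSet h
  rw [dualEnds, SimpleGraph.mem_edgeSet] at this
  obtain ⟨e', he', h'⟩ := this
  rwa [← dualEnds_injective (h'.trans rfl : dualEnds e' = dualEnds e)]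

theorem exists_box_of_finset (s : Finset Site) : ∃ r : ℕ, s ⊆ box 0 r := by
  induction s using Finset.induction_on with
  | empty => exact ⟨0, by simp⟩
  | insert a s _ ih =>
    obtain ⟨r, hr⟩ := ih
    refine ⟨r + a.1.natAbs + a.2.natAbs, fun x hx => ?_⟩
    rcases Finset.mem_insert.1 hx with rfl | hx
    · simp only [mem_box, Prod.fst_zero, Prod.snd_zero]; omega
    · have := hr hx
      simp only [mem_box, Prod.fst_zero, Prod.snd_zero] at this ⊢; omega

/-- A cycle of unsatisfied dual edges would be the boundary of a finite set of sites, violating the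
cut inequality. -/
theorem CutNonneg.isAcyclic {v : Edge → ℝ} (hv : CutNonneg v) : (unsat v).IsAcyclic := by
  intro f p hp
  have hnd := hp.edges_nodup
  have hmem : ∀ e, walkChain p e ≠ 0 → dualEnds e ∈ p.edges := fun e h => by
    by_contra h'; exact h (walkChain_eq_zero h')
  obtain ⟨r, hr⟩ := exists_box_of_finset p.support.toFinset
  obtain ⟨C, hC⟩ := exists_edgeBoundary (walkChain p) r (fun e he => hr (by
      have := hmem e he
      rw [dualEnds] at this
      exact List.mem_toFinset.2 (p.fst_mem_support_of_mem_edges this)))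
    (fun h => by
      rw [div_walkChain]
      split_ifs <;> decide)
  have hneg : ∀ e ∈ edgeBoundary C, v e < 0 := fun e he =>
    neg_of_mem_edges ((walkChain_eq_one_iff hnd e).1 ((hC e).1 he))
  have hne : (edgeBoundary C).Nonempty := by
    have hlen : p.edges ≠ [] := by
      have := hp.three_le_length
      rw [← p.length_edges] at this
      intro h
      simp [h] at this
    obtain ⟨t, ht⟩ := List.exists_mem_of_ne_nil _ hlen
    have ht' := p.edges_subset_edgeSet ht
    induction t using Sym2.ind with
    | _ a b =>
      obtain ⟨e, -, he⟩ := ht'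
      exact ⟨e, (hC e).2 ((walkChain_eq_one_iff hnd e).2 (he ▸ ht))⟩
  exact absurd (hv C) (not_le.2 (Finset.sum_neg hneg hne))

/-- The edges whose left or lower endpoint lies in the box. They include the edges within the box,
and those whose dual edge joins two dual sites of the box. -/
noncomputable def boxEdges (z : Site) (r : ℕ) : Finset Edge := box z r ×ˢ Finset.univ

theorem mem_boxEdges {z : Site} {r : ℕ} {e : Edge} : e ∈ boxEdges z r ↔ e.1 ∈ box z r := by
  simp [boxEdges]

/-- Two dual sites of a box are joined by a chain within that box. -/
theorem exists_chain_box {z : Site} {r : ℕ} {f g : DualSite} (hf : f ∈ box z r)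
    (hg : g ∈ box z r) :
    ∃ X : Edge → ZMod 2, (∀ e, X e ≠ 0 → e ∈ boxEdges z r) ∧
      ∀ h, div X h = (if h = f then 1 else 0) + (if h = g then 1 else 0) := by
  -- Being joined by such a chain is an equivalence relation.
  let R : DualSite → DualSite → Prop := fun f g =>
    ∃ X : Edge → ZMod 2, (∀ e, X e ≠ 0 → e ∈ boxEdges z r) ∧
      ∀ h, div X h = (if h = f then 1 else 0) + (if h = g then 1 else 0)
  have hrefl : ∀ f, R f f := fun f => ⟨0, by simp, fun h => by
    simp only [div, Pi.zero_apply]; split_ifs <;> decide⟩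
  have hsymm : ∀ f g, R f g → R g f := fun f g ⟨X, h1, h2⟩ =>
    ⟨X, h1, fun h => by rw [h2, add_comm]⟩
  have htrans : ∀ f g k, R f g → R g k → R f k := by
    rintro f g k ⟨X, h1, h2⟩ ⟨Y, h3, h4⟩
    refine ⟨X + Y, fun e he => ?_, fun h => ?_⟩
    · by_cases hx : X e = 0
      · exact h3 e (fun hy => he (by simp [hx, hy]))
      · exact h1 e hx
    · rw [div_add, h2, h4]
      have : ∀ a b c : ZMod 2, a + b + (b + c) = a + c := by decide
      exact this _ _ _
  have hstep : ∀ e : Edge, e.1 ∈ box z r → R e.1 (e.1 - step (!e.2)) := fun e he =>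
    ⟨Pi.single e 1, fun e' h => by
      rw [mem_boxEdges]
      by_cases h' : e' = e
      · rwa [h']
      · simp [h'] at h, fun h => div_single e h⟩
  have hcol : ∀ a b : ℤ, (a, b) ∈ box z r → R (a, b) (a, z.2 - r) := by
    intro a b hb
    have h1 : z.2 - r ≤ b := (mem_box.1 hb).2.1
    induction b, h1 using Int.leInduction with
    | base => exact hrefl _
    | succ b h ih =>
      simp only [mem_box] at hb ih
      have := hstep ((a, b + 1), false) (by simp [mem_box]; omega)
      simp only [Bool.not_false, step, Prod.mk_sub_mk, sub_zero, add_sub_cancel_right] at this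
      exact htrans _ _ _ this (ih (by omega))
  have hrow : ∀ a : ℤ, (a, z.2 - r) ∈ box z r → R (a, z.2 - r) (z.1 - r, z.2 - r) := by
    intro a hb
    have h1 : z.1 - r ≤ a := (mem_box.1 hb).1.1
    induction a, h1 using Int.leInduction with
    | base => exact hrefl _
    | succ b h ih =>
      simp only [mem_box] at hb ih
      have := hstep ((b + 1, z.2 - r), true) (by simp [mem_box]; omega)
      simp only [Bool.not_true, step, Prod.mk_sub_mk, sub_zero, add_sub_cancel_right] at this
      exact htrans _ _ _ this (ih (by omega))
  have hbase : ∀ f ∈ box z r, R f (z.1 - r, z.2 - r) := fun f hf =>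
    htrans _ _ _ (hcol f.1 f.2 hf) (hrow f.1 (by simp only [mem_box] at hf ⊢; omega))
  exact htrans _ _ _ (hbase f hf) (hsymm _ _ (hbase g hg))

/-- If the boundary of `C` consists of the edges in `I` and some of the edges in `B`, then the energy
gained on `I` is at most the weight of `B`. In the applications `C` is cut off along the boundary `B`
of an enclosing region. -/
theorem CutNonneg.neg_sum_le {v : Edge → ℝ} (hv : CutNonneg v) (C : Finset Site)
    (I B : Finset Edge) (hB : ∀ e ∈ edgeBoundary C, e ∉ B → e ∈ I) (hI : I ⊆ edgeBoundary C) :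
    -∑ e ∈ I, v e ≤ ∑ e ∈ B, |v e| := by
  have h1 := hv C
  have h2 : edgeBoundary C = I ∪ (edgeBoundary C \ I) := by
    rw [Finset.union_sdiff_of_subset hI]
  rw [h2, Finset.sum_union Finset.disjoint_sdiff] at h1
  have h3 : ∑ e ∈ edgeBoundary C \ I, v e ≤ ∑ e ∈ B, |v e| := by
    calc ∑ e ∈ edgeBoundary C \ I, v e ≤ ∑ e ∈ edgeBoundary C \ I, |v e| :=
          Finset.sum_le_sum fun e _ => le_abs_self _
      _ ≤ ∑ e ∈ B, |v e| := by
          refine Finset.sum_le_sum_of_subset_of_nonneg (fun e he => ?_) fun _ _ _ => abs_nonneg _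
          rw [Finset.mem_sdiff] at he
          by_contra h
          exact he.2 (hB e he.1 h)
  linarith

/-! ### Edge lists of lattice paths -/

/-- The moves on the dual lattice: the dual edge used and the dual site reached. -/
def dualMove (f : DualSite) : Bool × Bool → Edge × DualSite
  | (d, false) => ((f, d), f - step (!d))
  | (d, true) => ((f + step (!d), d), f + step (!d))

/-- The moves on the lattice: the edge used and the site reached. -/
def siteMove (x : Site) : Bool × Bool → Edge × Site
  | (d, false) => ((x, d), x + step d)
  | (d, true) => ((x - step d, d), x - step d)

/-- The lists of the edges used by `k` successive moves started from `x`. -/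
def pathLists (mv : Site → Bool × Bool → Edge × Site) : ℕ → Site → Finset (List Edge)
  | 0, _ => {[]}
  | k + 1, x => Finset.univ.biUnion fun i => (pathLists mv k (mv x i).2).image (List.cons (mv x i).1)

theorem card_pathLists_le (mv : Site → Bool × Bool → Edge × Site) (k : ℕ) (x : Site) :
    (pathLists mv k x).card ≤ 4 ^ k := by
  induction k generalizing x with
  | zero => simp [pathLists]
  | succ k ih =>
    refine Finset.card_biUnion_le.trans ?_
    calc _ ≤ ∑ _i : Bool × Bool, 4 ^ k :=
          Finset.sum_le_sum fun i _ => Finset.card_image_le.trans (ih _)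
      _ = 4 ^ (k + 1) := by simp [pow_succ, mul_comm]

theorem length_of_mem_pathLists {mv : Site → Bool × Bool → Edge × Site} {k : ℕ} {x : Site}
    {l : List Edge} (h : l ∈ pathLists mv k x) : l.length = k := by
  induction k generalizing x l with
  | zero => simp_all [pathLists]
  | succ k ih =>
    simp only [pathLists, Finset.mem_biUnion, Finset.mem_image, Finset.mem_univ, true_and] at h
    obtain ⟨i, l', hl', rfl⟩ := h
    simp [ih hl']

/-- A list of dual edges of length `k` stays within distance `k` of its start. -/
theorem mem_box_of_mem_pathLists {k : ℕ} {f : DualSite} {l : List Edge}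
    (h : l ∈ pathLists dualMove k f) {e : Edge} (he : e ∈ l) : e.1 ∈ box f k := by
  induction k generalizing f l with
  | zero => simp_all [pathLists]
  | succ k ih =>
    simp only [pathLists, Finset.mem_biUnion, Finset.mem_image, Finset.mem_univ, true_and] at h
    obtain ⟨⟨d, s⟩, l', hl', rfl⟩ := h
    rcases List.mem_cons.1 he with rfl | he
    · cases s <;> cases d <;> simp [dualMove, mem_box, step] <;> omega
    · have := ih hl' he
      cases s <;> cases d <;> simp [dualMove, mem_box, step] at this ⊢ <;> omega

/-- The first `k` edges of a walk form the edge list of `k` moves. -/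
theorem exists_pathList_of_walk {G : SimpleGraph Site} {mv : Site → Bool × Bool → Edge × Site}
    {ends : Edge → Sym2 Site} {P : Edge → Prop}
    (hmv : ∀ x y, G.Adj x y → ∃ i, (mv x i).2 = y ∧ ends (mv x i).1 = s(x, y) ∧ P (mv x i).1)
    {x y : Site} (p : G.Walk x y) {k : ℕ} (hk : k ≤ p.length) :
    ∃ l ∈ pathLists mv k x, l.map ends = p.edges.take k ∧ ∀ e ∈ l, P e := by
  induction p generalizing k with
  | nil =>
    obtain rfl : k = 0 := by simpa using hk
    exact ⟨[], by simp [pathLists], by simp, by simp⟩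
  | @cons x z y hadj p ih =>
    cases k with
    | zero => exact ⟨[], by simp [pathLists], by simp, by simp⟩
    | succ k =>
      obtain ⟨i, rfl, hi2, hi3⟩ := hmv _ _ hadj
      obtain ⟨l, hl, hl2, hl3⟩ := ih (k := k) (by simpa using hk)
      refine ⟨(mv x i).1 :: l, ?_, by simp [hl2, hi2], ?_⟩
      · simp only [pathLists, Finset.mem_biUnion, Finset.mem_image, Finset.mem_univ, true_and]
        exact ⟨i, l, hl, rfl⟩
      · exact List.forall_mem_cons.2 ⟨hi3, hl3⟩

theorem exists_dualMove {v : Edge → ℝ} (f g : DualSite) (h : (unsat v).Adj f g) :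
    ∃ i, (dualMove f i).2 = g ∧ dualEnds (dualMove f i).1 = s(f, g) ∧ v (dualMove f i).1 < 0 := by
  obtain ⟨e, he, h⟩ := h
  obtain ⟨x, d⟩ := e
  have h' := h
  simp only [dualEnds, Sym2.eq_iff] at h'
  rcases h' with ⟨rfl, h2⟩ | ⟨h1, h2⟩
  · exact ⟨(d, false), h2, h, he⟩
  · obtain rfl : f + step (!d) = x := by rw [← h2]; simp
    exact ⟨(d, true), h1, h, he⟩

/-- A function that changes by at most one along every edge changes by at most the length of a
walk. -/
theorem le_add_length {G : SimpleGraph Site} {φ : Site → ℕ}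
    (h : ∀ x y, G.Adj x y → φ x ≤ φ y + 1) {x y : Site} (p : G.Walk x y) :
    φ x ≤ φ y + p.length := by
  induction p with
  | nil => simp
  | cons hadj p ih =>
    have := h _ _ hadj
    simp only [SimpleGraph.Walk.length_cons]; omega

theorem unsat_adj_mem_box {v : Edge → ℝ} (f g : DualSite) (h : (unsat v).Adj f g) :
    g ∈ box f 1 := by
  obtain ⟨⟨d, s⟩, hi, -⟩ := exists_dualMove f g h
  cases s <;> cases d <;> simp [dualMove, step] at hi <;> subst hi <;> simp [mem_box] <;> omega

theorem mem_box_length {G : SimpleGraph Site} (h : ∀ x y, G.Adj x y → y ∈ box x 1) {x y : Site}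
    (p : G.Walk x y) : y ∈ box x p.length := by
  induction p with
  | nil => simp [mem_box]
  | cons hadj p ih =>
    have := h _ _ hadj
    simp only [mem_box, SimpleGraph.Walk.length_cons] at this ih ⊢
    omega

/-- The first `k` edges of a path of unsatisfied dual edges. -/
theorem exists_dualList {v : Edge → ℝ} {f g : DualSite} {p : (unsat v).Walk f g} (hp : p.IsPath)
    {k : ℕ} (hk : k ≤ p.length) :
    ∃ l ∈ pathLists dualMove k f, l.Nodup ∧ ∀ e ∈ l, dualEnds e ∈ p.edges := by
  obtain ⟨l, hl, hl2, -⟩ := exists_pathList_of_walk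
    (mv := dualMove) (ends := dualEnds) (P := fun e => v e < 0) exists_dualMove p hk
  refine ⟨l, hl, List.Nodup.of_map dualEnds (hl2 ▸ hp.isTrail.edges_nodup.sublist
    (List.take_sublist _ _)), fun e he => List.mem_of_mem_take (hl2 ▸ List.mem_map_of_mem he)⟩

/-! ### Union bounds over lattice paths -/

section Probability

variable {ν : Measure (Edge → ℝ)}

/-- A path of length `k` all of whose edges have a property of probability `q` exists with
probability at most `(4 q) ^ k`. -/
theorem real_exists_pathList_le {B : Set ℝ} {q : ℝ}
    (hq : ∀ s : Finset Edge, ν.real {v | ∀ e ∈ s, |v e| ∈ B} ≤ q ^ s.card)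
    (mv : Site → Bool × Bool → Edge × Site) (k : ℕ) (x : Site) :
    ν.real {v | ∃ l ∈ pathLists mv k x, l.Nodup ∧ ∀ e ∈ l, |v e| ∈ B} ≤ (4 * q) ^ k := by
  classical
  have hq0 : 0 ≤ q := by
    have := hq {((0, 0), false)}
    simp only [Finset.card_singleton, pow_one] at this
    exact measureReal_nonneg.trans this
  have h1 : {v : Edge → ℝ | ∃ l ∈ pathLists mv k x, l.Nodup ∧ ∀ e ∈ l, |v e| ∈ B}
      = ⋃ l ∈ (pathLists mv k x).filter List.Nodup, {v | ∀ e ∈ l.toFinset, |v e| ∈ B} := by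
    ext v; simp [and_assoc]
  rw [h1]
  refine (measureReal_biUnion_finset_le _ _).trans ?_
  calc _ ≤ ∑ l ∈ (pathLists mv k x).filter List.Nodup, q ^ k := by
        refine Finset.sum_le_sum fun l hl => ?_
        rw [Finset.mem_filter] at hl
        have := hq l.toFinset
        rwa [List.toFinset_card_of_nodup hl.2, length_of_mem_pathLists hl.1] at this
    _ ≤ (4 : ℝ) ^ k * q ^ k := by
        rw [Finset.sum_const, nsmul_eq_mul]
        gcongr
        exact_mod_cast (Finset.card_filter_le _ _).trans (card_pathLists_le mv k x)
    _ = _ := by rw [mul_pow]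

/-- A path of length `2 k` of total weight less than `c k` has at least `k` edges of weight at most
`c`. -/
theorem real_exists_light_le {c q : ℝ} (hc : 0 ≤ c)
    (hq : ∀ s : Finset Edge, ν.real {v | ∀ e ∈ s, |v e| ∈ Set.Iic c} ≤ q ^ s.card)
    (mv : Site → Bool × Bool → Edge × Site) [IsFiniteMeasure ν] (k : ℕ) (x : Site) :
    ν.real {v | ∃ l ∈ pathLists mv (2 * k) x, l.Nodup ∧ ∑ e ∈ l.toFinset, |v e| < c * k}
      ≤ (64 * q) ^ k := by
  classical
  have hq0 : 0 ≤ q := by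
    have := hq {((0, 0), false)}
    simp only [Finset.card_singleton, pow_one] at this
    exact measureReal_nonneg.trans this
  have h1 : {v : Edge → ℝ | ∃ l ∈ pathLists mv (2 * k) x, l.Nodup ∧
      ∑ e ∈ l.toFinset, |v e| < c * k}
      ⊆ ⋃ l ∈ (pathLists mv (2 * k) x).filter List.Nodup,
        ⋃ s ∈ l.toFinset.powersetCard k, {v | ∀ e ∈ s, |v e| ∈ Set.Iic c} := by
    rintro v ⟨l, hl, hnd, hsum⟩
    have hcard : l.toFinset.card = 2 * k := by
      rw [List.toFinset_card_of_nodup hnd, length_of_mem_pathLists hl]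
    have hk : k ≤ (l.toFinset.filter fun e => |v e| ≤ c).card := by
      by_contra hlt
      push Not at hlt
      have h2 := Finset.card_filter_add_card_filter_not (s := l.toFinset) (fun e => |v e| ≤ c)
      have h3 : k ≤ (l.toFinset.filter fun e => ¬ |v e| ≤ c).card := by omega
      have h4 : c * k ≤ ∑ e ∈ l.toFinset, |v e| := by
        calc c * k ≤ c * (l.toFinset.filter fun e => ¬ |v e| ≤ c).card := by gcongr
          _ = ∑ e ∈ l.toFinset.filter fun e => ¬ |v e| ≤ c, c := by
              rw [Finset.sum_const, nsmul_eq_mul, mul_comm]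
          _ ≤ ∑ e ∈ l.toFinset.filter fun e => ¬ |v e| ≤ c, |v e| :=
              Finset.sum_le_sum fun e he => (not_le.1 (Finset.mem_filter.1 he).2).le
          _ ≤ _ := Finset.sum_le_sum_of_subset_of_nonneg (Finset.filter_subset _ _)
              fun _ _ _ => abs_nonneg _
      linarith
    obtain ⟨s, hs, hsk⟩ := Finset.exists_subset_card_eq hk
    simp only [Set.mem_iUnion, Finset.mem_filter, Finset.mem_powersetCard]
    exact ⟨l, ⟨hl, hnd⟩, s, ⟨hs.trans (Finset.filter_subset _ _), hsk⟩,
      fun e he => (Finset.mem_filter.1 (hs he)).2⟩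
  refine (measureReal_mono h1 (measure_ne_top _ _)).trans ?_
  refine (measureReal_biUnion_finset_le _ _).trans ?_
  calc _ ≤ ∑ l ∈ (pathLists mv (2 * k) x).filter List.Nodup, (4 : ℝ) ^ k * q ^ k := by
        refine Finset.sum_le_sum fun l hl => (measureReal_biUnion_finset_le _ _).trans ?_
        rw [Finset.mem_filter] at hl
        calc _ ≤ ∑ s ∈ l.toFinset.powersetCard k, q ^ k :=
              Finset.sum_le_sum fun s hs => by
                rw [← (Finset.mem_powersetCard.1 hs).2]; exact hq s
          _ ≤ _ := by
              rw [Finset.sum_const, nsmul_eq_mul, Finset.card_powersetCard,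
                List.toFinset_card_of_nodup hl.2, length_of_mem_pathLists hl.1]
              gcongr
              have := Nat.choose_le_two_pow (2 * k) k
              rw [pow_mul] at this
              exact_mod_cast this
    _ ≤ ((4 : ℝ) ^ (2 * k)) * (4 ^ k * q ^ k) := by
        rw [Finset.sum_const, nsmul_eq_mul]
        gcongr
        exact_mod_cast (Finset.card_filter_le _ _).trans (card_pathLists_le mv (2 * k) x)
    _ = _ := by rw [pow_mul, ← mul_pow, ← mul_pow]; norm_num [mul_assoc]; ring

end Probability

/-! ### Enclosing a box by a contour of bounded couplings -/

/-- The `ℓ¹` distance of a site from the box of radius `m` around `z`. -/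
def distBox (z : Site) (m : ℕ) (x : Site) : ℕ :=
  ((x.1 - z.1).natAbs - m) + ((x.2 - z.2).natAbs - m)

theorem distBox_eq_zero {z x : Site} {m : ℕ} : distBox z m x = 0 ↔ x ∈ box z m := by
  rw [mem_box, distBox]; omega

/-- There is a path of length `k` from `x` whose edges all satisfy `M < |v e|`. -/
def HeavyPath (v : Edge → ℝ) (M : ℝ) (k : ℕ) (x : Site) : Prop :=
  ∃ l ∈ pathLists siteMove k x, l.Nodup ∧ ∀ e ∈ l, |v e| ∈ Set.Ioi M

/-- The graph of the edges with `M < |v e|`. -/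
def heavyGraph (v : Edge → ℝ) (M : ℝ) : SimpleGraph Site where
  Adj x y := ∃ e : Edge, M < |v e| ∧ s(e.src, e.tgt) = s(x, y)
  symm := ⟨by
    rintro f g ⟨e, he, h⟩
    exact ⟨e, he, h.trans Sym2.eq_swap⟩⟩
  loopless := ⟨by
    rintro f ⟨⟨v, d⟩, -, h⟩
    cases d <;> simp [Edge.src, Edge.tgt, step, Prod.ext_iff] at h <;> grind⟩

theorem exists_siteMove {x y : Site} {e : Edge} (h : s(e.src, e.tgt) = s(x, y)) :
    ∃ i, siteMove x i = (e, y) := by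
  obtain ⟨u, d⟩ := e
  simp only [Edge.src, Edge.tgt, Sym2.eq_iff] at h
  rcases h with ⟨rfl, rfl⟩ | ⟨h1, h2⟩
  · exact ⟨(d, false), rfl⟩
  · subst h1
    refine ⟨(d, true), ?_⟩
    simp [siteMove, ← h2]

theorem exists_siteMove_heavy {v : Edge → ℝ} {M : ℝ} (x y : Site)
    (h : (heavyGraph v M).Adj x y) :
    ∃ i, (siteMove x i).2 = y ∧ s((siteMove x i).1.src, (siteMove x i).1.tgt) = s(x, y) ∧
      |v (siteMove x i).1| ∈ Set.Ioi M := by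
  obtain ⟨e, he, h⟩ := h
  obtain ⟨i, hi⟩ := exists_siteMove h
  exact ⟨i, by rw [hi], by rw [hi]; exact h, by rw [hi]; exact he⟩

theorem heavyPath_of_isPath {v : Edge → ℝ} {M : ℝ} {x y : Site} {p : (heavyGraph v M).Walk x y}
    (hp : p.IsPath) {k : ℕ} (hk : k ≤ p.length) : HeavyPath v M k x := by
  obtain ⟨l, hl, hl2, hl3⟩ := exists_pathList_of_walk (mv := siteMove)
    (ends := fun e => s(e.src, e.tgt)) (P := fun e => |v e| ∈ Set.Ioi M) exists_siteMove_heavy p hk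
  exact ⟨l, hl, List.Nodup.of_map _ (hl2 ▸ hp.isTrail.edges_nodup.sublist
    (List.take_sublist _ _)), hl3⟩

theorem siteMove_mem_box (x : Site) (i : Bool × Bool) : (siteMove x i).2 ∈ box x 1 := by
  obtain ⟨d, s⟩ := i
  cases s <;> cases d <;> simp [siteMove, mem_box, step] <;> omega

theorem distBox_siteMove (z : Site) (m : ℕ) (x : Site) (i : Bool × Bool) :
    distBox z m x ≤ distBox z m (siteMove x i).2 + 1 := by
  obtain ⟨d, s⟩ := i
  cases s <;> cases d <;> simp [siteMove, distBox, step] <;> omega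

/-- The sites around the box of radius `m` at which a heavy path starts that is one step shorter
than the distance to the box. Sites next to the box qualify because the path is empty. -/
noncomputable def heavyShell (v : Edge → ℝ) (M : ℝ) (z : Site) (m : ℕ) : Finset Site :=
  open Classical in
  (box z (2 * m) \ box z m).filter fun x => HeavyPath v M (distBox z m x - 1) x

/-- The box together with the clusters of heavy edges touching it has a boundary without heavy
edges, and every edge of this boundary has an endpoint in the heavy shell. -/
theorem exists_enclosure {v : Edge → ℝ} {M : ℝ} {z : Site} {m : ℕ} (hm : 1 ≤ m) (hM : 0 ≤ M)
    (h : ∀ b ∈ box z m, ¬ HeavyPath v M m b) :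
    ∃ D : Finset Site, box z m ⊆ D ∧ D ⊆ box z (2 * m) ∧
      ∑ e ∈ edgeBoundary D, |v e| ≤ 4 * M * (heavyShell v M z m).card := by
  classical
  let D : Finset Site :=
    (box z (2 * m)).filter fun y => ∃ b ∈ box z m, (heavyGraph v M).Reachable b y
  have hD : ∀ b ∈ box z m, ∀ y, (heavyGraph v M).Reachable b y → y ∈ D := by
    intro b hb y hby
    refine Finset.mem_filter.2 ⟨?_, b, hb, hby⟩
    obtain ⟨p, hp⟩ := hby.exists_isPath
    have hlen : p.length < m := by
      by_contra hlt
      exact h b hb (heavyPath_of_isPath hp (not_lt.1 hlt))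
    have hbox : y ∈ box b p.length := mem_box_length (fun x y hxy => by
      obtain ⟨i, hi, -⟩ := exists_siteMove_heavy x y hxy
      exact hi ▸ siteMove_mem_box x i) p
    simp only [mem_box] at hbox hb ⊢
    omega
  have hbD : box z m ⊆ D := fun b hb => hD b hb b (SimpleGraph.Reachable.refl _)
  refine ⟨D, hbD, Finset.filter_subset _ _, ?_⟩
  have hlight : ∀ e ∈ edgeBoundary D, |v e| ≤ M := by
    intro e he
    by_contra hlt
    have hadj : (heavyGraph v M).Adj e.src e.tgt := ⟨e, not_le.1 hlt, rfl⟩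
    rcases (mem_edgeBoundary D e).1 he with ⟨h1, h2⟩ | ⟨h1, h2⟩
    · obtain ⟨-, b, hb, hr⟩ := Finset.mem_filter.1 h1
      exact h2 (hD b hb _ (hr.trans hadj.reachable))
    · obtain ⟨-, b, hb, hr⟩ := Finset.mem_filter.1 h2
      exact h1 (hD b hb _ (hr.trans hadj.symm.reachable))
  have hend : ∀ e x y, s(e.src, e.tgt) = s(x, y) → x ∈ D → y ∉ D →
      e ∈ (heavyShell v M z m).biUnion fun x =>
        Finset.univ.image fun i => (siteMove x i).1 := by
    intro e x y hexy hx hy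
    simp only [Finset.mem_biUnion, Finset.mem_image, Finset.mem_univ, true_and]
    obtain ⟨hx2, b, hb, hr⟩ := Finset.mem_filter.1 hx
    by_cases hxb : x ∈ box z m
    · -- The endpoint outside the box is at distance one from it.
      obtain ⟨i, hi⟩ := exists_siteMove (hexy.trans Sym2.eq_swap)
      refine ⟨y, ?_, i, by rw [hi]⟩
      have hyb : y ∉ box z m := fun h => hy (hbD h)
      have h1 := distBox_siteMove z m y i
      rw [hi, distBox_eq_zero.2 hxb] at h1
      have h2 : distBox z m y - 1 = 0 := by omega
      refine Finset.mem_filter.2 ⟨Finset.mem_sdiff.2 ⟨?_, hyb⟩, ?_⟩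
      · obtain ⟨j, hj⟩ := exists_siteMove hexy
        have h3 := siteMove_mem_box x j
        rw [hj] at h3
        simp only [mem_box] at h3 hxb ⊢
        omega
      · rw [h2]
        exact ⟨[], by simp [pathLists], by simp, by simp⟩
    · obtain ⟨i, hi⟩ := exists_siteMove hexy
      refine ⟨x, ?_, i, by rw [hi]⟩
      refine Finset.mem_filter.2 ⟨Finset.mem_sdiff.2 ⟨hx2, hxb⟩, ?_⟩
      obtain ⟨p, hp⟩ := hr.symm.exists_isPath
      refine heavyPath_of_isPath hp ?_
      have h1 := le_add_length (φ := distBox z m) (fun x y hxy => by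
        obtain ⟨i, hi, -⟩ := exists_siteMove_heavy x y hxy
        have := distBox_siteMove z m x i
        rwa [hi] at this) p
      rw [distBox_eq_zero.2 hb] at h1
      omega
  have hsub : edgeBoundary D ⊆ (heavyShell v M z m).biUnion fun x =>
      Finset.univ.image fun i => (siteMove x i).1 := by
    intro e he
    rcases (mem_edgeBoundary D e).1 he with ⟨h1, h2⟩ | ⟨h1, h2⟩
    · exact hend e _ _ rfl h1 h2
    · exact hend e _ _ Sym2.eq_swap h2 h1
  have hcard : (edgeBoundary D).card ≤ 4 * (heavyShell v M z m).card := by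
    refine (Finset.card_le_card hsub).trans ((Finset.card_biUnion_le_card_mul _ _ 4 ?_).trans ?_)
    · intro x _
      exact Finset.card_image_le.trans (by simp)
    · rw [mul_comm]
  calc ∑ e ∈ edgeBoundary D, |v e| ≤ ∑ e ∈ edgeBoundary D, M := Finset.sum_le_sum hlight
    _ = (edgeBoundary D).card * M := by rw [Finset.sum_const, nsmul_eq_mul]
    _ ≤ (4 * (heavyShell v M z m).card : ℕ) * M := by gcongr
    _ = _ := by push_cast; ring

/-- A second moment bound for the number of events that occur. No independence is needed, as
`ν (E i ∩ E j) ≤ min (b i ^ 2) (b j ^ 2) ≤ b i * b j`. -/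
theorem real_le_sum_indicator_le {Ω ι : Type*} [MeasurableSpace Ω] {ν : Measure Ω}
    [IsFiniteMeasure ν] (T : Finset ι) {E : ι → Set Ω} (hE : ∀ i, MeasurableSet (E i))
    {b : ι → ℝ} (hb : ∀ i ∈ T, 0 ≤ b i) (h : ∀ i ∈ T, ν.real (E i) ≤ b i ^ 2) {t : ℝ}
    (ht : 0 < t) :
    ν.real {ω | t ≤ ∑ i ∈ T, (E i).indicator 1 ω} ≤ ((∑ i ∈ T, b i) / t) ^ 2 := by
  have hsq : ∀ ω, (∑ i ∈ T, (E i).indicator (1 : Ω → ℝ) ω) ^ 2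
      = ∑ i ∈ T, ∑ j ∈ T, (E i ∩ E j).indicator (1 : Ω → ℝ) ω := by
    intro ω
    rw [sq, Finset.sum_mul_sum]
    refine Finset.sum_congr rfl fun i _ => Finset.sum_congr rfl fun j _ => ?_
    rw [Set.inter_indicator_one, Pi.mul_apply]
  have hint : ∀ i j, Integrable ((E i ∩ E j).indicator (1 : Ω → ℝ)) ν := fun i j =>
    (integrable_const (1 : ℝ)).indicator ((hE i).inter (hE j))
  have h1 : ∫ ω, (∑ i ∈ T, (E i).indicator (1 : Ω → ℝ) ω) ^ 2 ∂ν ≤ (∑ i ∈ T, b i) ^ 2 := by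
    simp only [hsq]
    rw [integral_finsetSum _ fun i _ => integrable_finsetSum _ fun j _ => hint i j, sq,
      Finset.sum_mul_sum]
    refine Finset.sum_le_sum fun i hi => ?_
    rw [integral_finsetSum _ fun j _ => hint i j]
    refine Finset.sum_le_sum fun j hj => ?_
    rw [integral_indicator_one ((hE i).inter (hE j))]
    have h2 : ν.real (E i ∩ E j) ≤ b i ^ 2 :=
      (measureReal_mono Set.inter_subset_left).trans (h i hi)
    have h3 : ν.real (E i ∩ E j) ≤ b j ^ 2 :=
      (measureReal_mono Set.inter_subset_right).trans (h j hj)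
    rcases le_total (b i) (b j) with hij | hij
    · nlinarith [hb i hi, hb j hj]
    · nlinarith [hb i hi, hb j hj]
  have h2 := mul_meas_ge_le_integral_of_nonneg (μ := ν)
    (f := fun ω => (∑ i ∈ T, (E i).indicator (1 : Ω → ℝ) ω) ^ 2)
    (Filter.Eventually.of_forall fun ω => sq_nonneg _)
    (by
      simp only [hsq]
      exact integrable_finsetSum _ fun i _ => integrable_finsetSum _ fun j _ => hint i j)
    (t ^ 2)
  rw [div_pow, le_div_iff₀ (by positivity), mul_comm]
  refine le_trans ?_ (h2.trans h1)
  gcongr ?_ * ?_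
  exact measureReal_mono (fun ω hω => pow_le_pow_left₀ ht.le hω 2) (measure_ne_top _ _)

theorem sum_quarter_pow_le (m : ℕ) (z : ℤ) (R : ℕ) :
    ∑ a ∈ Finset.Icc (z - (m + R : ℕ)) (z + (m + R : ℕ)), (1 / 4 : ℝ) ^ ((a - z).natAbs - m)
      ≤ 2 * m + 2 - (1 / 4) ^ R := by
  induction R with
  | zero =>
    have h1 : ∀ a ∈ Finset.Icc (z - (m + 0 : ℕ)) (z + (m + 0 : ℕ)),
        (1 / 4 : ℝ) ^ ((a - z).natAbs - m) = 1 := by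
      intro a ha
      rw [Finset.mem_Icc] at ha
      rw [show (a - z).natAbs - m = 0 by omega, pow_zero]
    rw [Finset.sum_congr rfl h1]
    have : (z + (m : ℤ) + 1 - (z - m)).toNat = 2 * m + 1 := by omega
    simp [this]
    linarith
  | succ R ih =>
    have h1 : Finset.Icc (z - (m + (R + 1) : ℕ)) (z + (m + (R + 1) : ℕ))
        = insert (z - (m + (R + 1) : ℕ)) (insert (z + (m + (R + 1) : ℕ))
          (Finset.Icc (z - (m + R : ℕ)) (z + (m + R : ℕ)))) := by
      ext a
      simp only [Finset.mem_insert, Finset.mem_Icc]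
      omega
    rw [h1, Finset.sum_insert (by simp only [Finset.mem_insert, Finset.mem_Icc]; omega),
      Finset.sum_insert (by simp only [Finset.mem_Icc]; omega),
      show (z - (m + (R + 1) : ℕ) - z).natAbs - m = R + 1 by omega,
      show (z + (m + (R + 1) : ℕ) - z).natAbs - m = R + 1 by omega]
    have : (0 : ℝ) < (1 / 4) ^ R := by positivity
    rw [pow_succ]
    linarith

theorem sum_shell_le {m : ℕ} (hm : 1 ≤ m) (z : Site) :
    ∑ x ∈ box z (2 * m) \ box z m, (1 / 4 : ℝ) ^ distBox z m x ≤ 7 * m := by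
  have h1 : ∑ x ∈ box z (2 * m), (1 / 4 : ℝ) ^ distBox z m x ≤ (2 * m + 2) ^ 2 := by
    have h2 : ∀ c : ℤ, ∑ a ∈ Finset.Icc (c - (2 * m : ℕ)) (c + (2 * m : ℕ)),
        (1 / 4 : ℝ) ^ ((a - c).natAbs - m) ≤ 2 * m + 2 := fun c => by
      have := sum_quarter_pow_le m c m
      rw [← two_mul] at this
      refine this.trans (sub_le_self _ (by positivity))
    simp only [box, distBox, pow_add]
    rw [Finset.sum_product]
    dsimp only
    rw [← Finset.sum_mul_sum, sq]
    exact mul_le_mul (h2 _) (h2 _) (Finset.sum_nonneg fun _ _ => by positivity) (by positivity)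
  have h3 : ∑ x ∈ box z m, (1 / 4 : ℝ) ^ distBox z m x = (2 * m + 1) ^ 2 := by
    rw [Finset.sum_congr rfl fun x hx => by rw [distBox_eq_zero.2 hx, pow_zero]]
    simp [card_box]
  have h4 := Finset.sum_sdiff (f := fun x => (1 / 4 : ℝ) ^ distBox z m x)
    (show box z m ⊆ box z (2 * m) from fun x hx => by simp only [mem_box] at hx ⊢; omega)
  have h5 : (1 : ℝ) ≤ m := by exact_mod_cast hm
  nlinarith

theorem measurableSet_heavyPath (M : ℝ) (k : ℕ) (x : Site) :
    MeasurableSet {v : Edge → ℝ | HeavyPath v M k x} := by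
  have h1 : {v : Edge → ℝ | HeavyPath v M k x}
      = ⋃ l ∈ (pathLists siteMove k x).filter List.Nodup, ⋂ e ∈ l.toFinset,
        {v | |v e| ∈ Set.Ioi M} := by
    ext v; simp [HeavyPath, and_assoc]
  rw [h1]
  refine Finset.measurableSet_biUnion _ fun l _ => Finset.measurableSet_biInter _ fun e _ => ?_
  exact (measurable_pi_apply e).abs measurableSet_Ioi

/-- A region between the boxes of radius `m` and `2 m` around `z` whose boundary has total weight
at most `s m`. -/
def Enclosed (v : Edge → ℝ) (z : Site) (m : ℕ) (s : ℝ) : Prop :=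
  ∃ D : Finset Site, box z m ⊆ D ∧ D ⊆ box z (2 * m) ∧ ∑ e ∈ edgeBoundary D, |v e| ≤ s * m

/-- No moment of the coupling distribution is assumed, but a box can be enclosed by a contour of
weight proportional to its radius. The bound on the failure probability decays like `s⁻²`, which is
better than what the first moment of the size of the heavy shell would give. -/
theorem real_not_enclosed_le {ν : Measure (Edge → ℝ)} [IsFiniteMeasure ν] {M : ℝ} (hM : 0 < M)
    (hq : ∀ s : Finset Edge, ν.real {v | ∀ e ∈ s, |v e| ∈ Set.Ioi M} ≤ (1 / 64 : ℝ) ^ s.card)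
    {m : ℕ} (hm : 1 ≤ m) {s : ℝ} (hs : 0 < s) (z : Site) :
    ν.real {v | ¬ Enclosed v z m s} ≤ (112 * M / s) ^ 2 + (2 * m + 1) ^ 2 * (1 / 16) ^ m := by
  classical
  have hheavy : ∀ k x, ν.real {v | HeavyPath v M k x} ≤ (1 / 16 : ℝ) ^ k := fun k x => by
    have := real_exists_pathList_le hq siteMove k x
    rwa [show (4 : ℝ) * (1 / 64) = 1 / 16 by norm_num] at this
  have hm' : (0 : ℝ) < m := by exact_mod_cast hm
  set T := box z (2 * m) \ box z m with hT
  set E : Site → Set (Edge → ℝ) := fun x => {v | HeavyPath v M (distBox z m x - 1) x} with hE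
  set t : ℝ := s * m / (4 * M) with ht
  have hsub : {v | ¬ Enclosed v z m s} ⊆
      {v | t ≤ ∑ x ∈ T, (E x).indicator 1 v} ∪ ⋃ b ∈ box z m, {v | HeavyPath v M m b} := by
    intro v hv
    by_contra hcon
    simp only [Set.mem_union, Set.mem_ofPred_eq, Set.mem_iUnion, not_or, not_exists, not_le] at hcon
    obtain ⟨h1, h2⟩ := hcon
    obtain ⟨D, hD1, hD2, hD3⟩ := exists_enclosure hm hM.le (fun b hb => h2 b hb)
    refine hv ⟨D, hD1, hD2, hD3.trans ?_⟩
    have h3 : ∑ x ∈ T, (E x).indicator (1 : (Edge → ℝ) → ℝ) v = (heavyShell v M z m).card := by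
      simp [heavyShell, Set.indicator_apply, hE, hT]
    rw [h3, ht, lt_div_iff₀ (by positivity)] at h1
    linarith
  refine (measureReal_mono hsub (measure_ne_top _ _)).trans ((measureReal_union_le _ _).trans
    (add_le_add ?_ ?_))
  · have h1 := real_le_sum_indicator_le (ν := ν) T (E := E)
      (fun x => measurableSet_heavyPath M _ x) (b := fun x => 4 * (1 / 4) ^ distBox z m x)
      (fun x _ => by positivity) (fun x hx => by
        refine (hheavy _ _).trans (le_of_eq ?_)
        have h2 : distBox z m x ≠ 0 := fun h => (Finset.mem_sdiff.1 hx).2 (distBox_eq_zero.1 h)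
        obtain ⟨j, hj⟩ := Nat.exists_eq_succ_of_ne_zero h2
        rw [hj, Nat.succ_sub_one, mul_pow, ← pow_mul, mul_comm j.succ 2, pow_mul,
          show (4 : ℝ) ^ 2 = 16 by norm_num, show (1 / 4 : ℝ) ^ 2 = 1 / 16 by norm_num,
          pow_succ]
        ring) (t := t) (by positivity)
    refine h1.trans (pow_le_pow_left₀ (by positivity) ?_ 2)
    rw [← Finset.mul_sum, ht, div_div_eq_mul_div, div_le_div_iff₀ (by positivity) hs]
    have h2 := sum_shell_le hm z
    calc 4 * (∑ x ∈ T, (1 / 4 : ℝ) ^ distBox z m x) * (4 * M) * s ≤ 4 * (7 * m) * (4 * M) * s := by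
          gcongr
      _ = _ := by ring
  · refine (measureReal_biUnion_finset_le _ _).trans ?_
    calc _ ≤ ∑ b ∈ box z m, (1 / 16 : ℝ) ^ m := Finset.sum_le_sum fun b _ => hheavy m b
      _ = _ := by rw [Finset.sum_const, nsmul_eq_mul, card_box]; push_cast; ring

/-! ### Two infinite components in many places cost too much energy -/

/-- The component of `f` in the graph of unsatisfied dual edges is infinite. -/
def InfComp (v : Edge → ℝ) (f : DualSite) : Prop := {g | (unsat v).Reachable f g}.Infinite

/-- The box of radius `M` around `z` meets two infinite components. -/
def TwoInf (v : Edge → ℝ) (z : Site) (M : ℕ) : Prop :=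
  ∃ f ∈ box z M, ∃ g ∈ box z M, InfComp v f ∧ InfComp v g ∧ ¬ (unsat v).Reachable f g

/-- A nontrivial linear functional on the subsets of `Z`, modulo two, takes the value one on half
of them. -/
theorem sum_powerset_eq {ι : Type*} (Z : Finset ι) (y : ι → ZMod 2) :
    ∑ S ∈ Z.powerset, (open Classical in if ∑ z ∈ S, y z = 1 then (1 : ℝ) else 0)
      = open Classical in if ∃ z ∈ Z, y z = 1 then 2 ^ Z.card / 2 else 0 := by
  classical
  have h01 : ∀ t : ZMod 2, t ≠ 1 → t = 0 := by decide
  split_ifs with h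
  · obtain ⟨z, hz, hy⟩ := h
    obtain ⟨Z', hz', rfl⟩ : ∃ Z', z ∉ Z' ∧ insert z Z' = Z :=
      ⟨Z.erase z, Finset.notMem_erase _ _, Finset.insert_erase hz⟩
    rw [Finset.sum_powerset_insert hz', ← Finset.sum_add_distrib]
    have h1 : ∀ S ∈ Z'.powerset, ((if ∑ z ∈ S, y z = 1 then (1 : ℝ) else 0)
        + if ∑ z ∈ insert z S, y z = 1 then (1 : ℝ) else 0) = 1 := by
      intro S hS
      rw [Finset.sum_insert (fun h => hz' (Finset.mem_powerset.1 hS h)), hy]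
      by_cases h2 : ∑ z ∈ S, y z = 1
      · rw [h2]; simp
      · rw [h01 _ h2]; simp
    rw [Finset.sum_congr rfl h1, Finset.card_insert_of_notMem hz']
    simp [pow_succ]
  · push Not at h
    refine Finset.sum_eq_zero fun S hS => if_neg ?_
    rw [Finset.sum_eq_zero fun z hz => h01 _ (h z (Finset.mem_powerset.1 hS hz))]
    decide

theorem InfComp.exists_path {v : Edge → ℝ} {f : DualSite} (h : InfComp v f) (r : ℕ) :
    ∃ g ∉ box 0 r, ∃ p : (unsat v).Walk f g, p.IsPath := by
  obtain ⟨g, hg, hgr⟩ := h.exists_notMem_finset (box 0 r)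
  exact ⟨g, hgr, hg.exists_isPath⟩

/-- Averaging over the subsets of a family of chains without boundary in an enclosed region: the
edges used by at least one of the chains have total value at least minus twice the weight of the
boundary of the region. -/
theorem CutNonneg.neg_sum_chains_le {v : Edge → ℝ} (hv : CutNonneg v) {R : ℕ} {D : Finset Site}
    (hD : D ⊆ box 0 R) (Z : Finset Site) (Y : Site → Edge → ZMod 2)
    (hY : ∀ z ∈ Z, ∀ f ∈ box 0 R, div (Y z) f = 0) :
    -∑ e ∈ (open Classical in (D ×ˢ (Finset.univ : Finset Bool)).filter fun e : Edge =>
        e.tgt ∈ D ∧ ∃ z ∈ Z, Y z e = 1), v e ≤ 2 * ∑ e ∈ edgeBoundary D, |v e| := by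
  classical
  set E : Finset Edge := (D ×ˢ (Finset.univ : Finset Bool)).filter fun e : Edge => e.tgt ∈ D with hE
  clear_value E
  have hmemE : ∀ e : Edge, e ∈ E ↔ e.src ∈ D ∧ e.tgt ∈ D := fun e => by
    simp [hE, Edge.src]
  have h1 : ∀ S ∈ Z.powerset, -∑ e ∈ E, (if ∑ z ∈ S, Y z e = 1 then (1 : ℝ) else 0) * v e
      ≤ ∑ e ∈ edgeBoundary D, |v e| := by
    intro S hS
    have hdiv : ∀ f ∈ box 0 R, div (∑ z ∈ S, Y z) f = 0 := fun f hf => by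
      rw [div_sum]
      exact Finset.sum_eq_zero fun z hz => hY z (Finset.mem_powerset.1 hS hz) f hf
    have hgr := potential_grad (R := R) _ hdiv
    have hb : ∀ e ∈ E, (e ∈ edgeBoundary (D.filter fun x => potential R (∑ z ∈ S, Y z) x = 1) ↔
        ∑ z ∈ S, Y z e = 1) := by
      intro e he
      obtain ⟨hs, ht⟩ := (hmemE e).1 he
      have h2 := hgr e (hD hs) (hD ht)
      rw [Finset.sum_apply] at h2
      rw [mem_edgeBoundary]
      simp only [Finset.mem_filter, hs, ht, true_and, h2]
      have : ∀ p q : ZMod 2, p = 1 ∧ ¬ p + q = 1 ∨ ¬ p = 1 ∧ p + q = 1 ↔ q = 1 := by decide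
      exact this _ _
    have h3 := hv.neg_sum_le (D.filter fun x => potential R (∑ z ∈ S, Y z) x = 1)
      (E.filter fun e => ∑ z ∈ S, Y z e = 1) (edgeBoundary D)
      (fun e he heD => by
        have heE : e ∈ E := by
          rw [mem_edgeBoundary] at he heD
          simp only [Finset.mem_filter] at he
          rw [hmemE]; tauto
        exact Finset.mem_filter.2 ⟨heE, (hb e heE).1 he⟩)
      (fun e he => by
        obtain ⟨h4, h5⟩ := Finset.mem_filter.1 he
        exact (hb e h4).2 h5)
    simpa [Finset.sum_filter, ite_mul] using h3
  have h2 := Finset.sum_le_sum h1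
  rw [Finset.sum_neg_distrib, Finset.sum_comm, Finset.sum_const, Finset.card_powerset,
    nsmul_eq_mul] at h2
  have h3 : ∑ e ∈ E, ∑ S ∈ Z.powerset, (if ∑ z ∈ S, Y z e = 1 then (1 : ℝ) else 0) * v e
      = 2 ^ Z.card / 2 * ∑ e ∈ E.filter fun e => ∃ z ∈ Z, Y z e = 1, v e := by
    rw [Finset.sum_filter, Finset.mul_sum]
    refine Finset.sum_congr rfl fun e _ => ?_
    rw [← Finset.sum_mul, sum_powerset_eq]
    split_ifs <;> simp
  rw [h3] at h2
  have h4 : (0 : ℝ) < 2 ^ Z.card := by positivity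
  push_cast at h2
  have h5 : E.filter (fun e => ∃ z ∈ Z, Y z e = 1) = (D ×ˢ (Finset.univ : Finset Bool)).filter
      fun e : Edge => e.tgt ∈ D ∧ ∃ z ∈ Z, Y z e = 1 := by
    rw [hE, Finset.filter_filter]
  rw [← h5]
  by_contra hcon
  push Not at hcon
  have h6 := mul_lt_mul_of_pos_left hcon h4
  linarith

/-- Near each `z ∈ Z` two infinite components are joined at cost `K`; on the paths to infinity a
weight of at least `w` is gained near `z`. -/
theorem CutNonneg.card_mul_le {v : Edge → ℝ} (hv : CutNonneg v) {Z : Finset Site} {M k N : ℕ}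
    {w K s : ℝ} (hZ : ∀ z ∈ Z, box z (M + k + 1) ⊆ box 0 N)
    (hdisj : ∀ z ∈ Z, ∀ z' ∈ Z, z ≠ z' → Disjoint (box z (M + k)) (box z' (M + k)))
    (htwo : ∀ z ∈ Z, TwoInf v z M)
    (hcost : ∀ z ∈ Z, ∑ e ∈ boxEdges z M, |v e| ≤ K)
    (hgain : ∀ z ∈ Z, ∀ f ∈ box z M, ∀ l ∈ pathLists dualMove k f, l.Nodup →
      w ≤ ∑ e ∈ l.toFinset, |v e|)
    (hencl : Enclosed v 0 N s) :
    Z.card * (w - 2 * K) ≤ 2 * (s * N) := by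
  classical
  obtain ⟨D, hD1, hD2, hD3⟩ := hencl
  have key : ∀ z ∈ Z, ∃ (Y : Edge → ZMod 2) (A : Finset Edge),
      (∀ f ∈ box 0 (2 * N), div Y f = 0) ∧ (∀ e, Y e = 1 → e ∉ boxEdges z M → v e < 0) ∧
      (∀ e ∈ A, Y e = 1 ∧ e.1 ∈ box z (M + k) ∧ e.1 ∉ box z M) ∧ w - K ≤ ∑ e ∈ A, |v e| := by
    intro z hz
    obtain ⟨f, hf, g, hg, hfi, hgi, hfg⟩ := htwo z hz
    obtain ⟨f', hf', p, hp⟩ := hfi.exists_path (2 * N)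
    obtain ⟨g', hg', q, hq⟩ := hgi.exists_path (2 * N)
    obtain ⟨X, hX1, hX2⟩ := exists_chain_box hf hg
    have hk : k ≤ p.length := by
      by_contra hlt
      push Not at hlt
      have h1 := mem_box_length unsat_adj_mem_box p
      have h2 : f' ∈ box z (M + k + 1) := by
        simp only [mem_box] at h1 hf ⊢; omega
      have h3 := hZ z hz h2
      apply hf'
      simp only [mem_box] at h3 ⊢; omega
    obtain ⟨l, hl, hnd, hlp⟩ := exists_dualList hp hk
    have h01 : ∀ t : ZMod 2, t ≠ 0 → t = 1 := by decide
    refine ⟨walkChain p + X + walkChain q, l.toFinset \ boxEdges z M, ?_, ?_, ?_, ?_⟩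
    · intro h hh
      rw [div_add, div_add, div_walkChain, div_walkChain, hX2,
        if_neg (ne_of_mem_of_not_mem hh hf'),
        if_neg (ne_of_mem_of_not_mem hh hg')]
      split_ifs <;> decide
    · intro e he heb
      have hXe : X e = 0 := by
        by_contra h; exact heb (hX1 e h)
      by_cases h1 : dualEnds e ∈ p.edges
      · exact neg_of_mem_edges h1
      · by_cases h2 : dualEnds e ∈ q.edges
        · exact neg_of_mem_edges h2
        · simp [walkChain_eq_zero h1, walkChain_eq_zero h2, hXe] at he
    · intro e he
      rw [Finset.mem_sdiff, List.mem_toFinset, mem_boxEdges] at he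
      have hXe : X e = 0 := by
        by_contra h; exact he.2 (mem_boxEdges.1 (hX1 e h))
      refine ⟨?_, ?_, he.2⟩
      · have hep := hlp e he.1
        have heq : dualEnds e ∉ q.edges := by
          intro heq
          -- An edge on both paths would connect `f` with `g`.
          have h1 : e.1 ∈ p.support := p.fst_mem_support_of_mem_edges hep
          have h2 : e.1 ∈ q.support := q.fst_mem_support_of_mem_edges heq
          exact hfg ((p.takeUntil _ h1).reachable.trans (q.takeUntil _ h2).reachable.symm)
        simp [(walkChain_eq_one_iff hp.isTrail.edges_nodup e).2 hep, walkChain_eq_zero heq, hXe]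
      · have := mem_box_of_mem_pathLists hl he.1
        simp only [mem_box] at this hf ⊢
        omega
    · have h1 := hgain z hz f hf l hl hnd
      have h2 : ∑ e ∈ l.toFinset, |v e| ≤
          ∑ e ∈ l.toFinset \ boxEdges z M, |v e| + ∑ e ∈ boxEdges z M, |v e| := by
        rw [← Finset.sum_union Finset.sdiff_disjoint]
        refine Finset.sum_le_sum_of_subset_of_nonneg (fun e he => ?_) fun _ _ _ => abs_nonneg _
        by_cases h : e ∈ boxEdges z M
        · exact Finset.mem_union_right _ h
        · exact Finset.mem_union_left _ (Finset.mem_sdiff.2 ⟨he, h⟩)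
      linarith [hcost z hz]
  choose! Y A hY1 hY2 hA1 hA2 using key
  have h1 := hv.neg_sum_chains_le hD2 Z Y hY1
  set H := (D ×ˢ (Finset.univ : Finset Bool)).filter fun e : Edge =>
        e.tgt ∈ D ∧ ∃ z ∈ Z, Y z e = 1 with hH
  set W := Z.biUnion fun z => boxEdges z M with hW
  have hAdisj : ∀ z ∈ Z, ∀ z' ∈ Z, z ≠ z' → Disjoint (A z) (A z') := by
    intro z hz z' hz' hne
    rw [Finset.disjoint_left]
    intro e he he'
    exact Finset.disjoint_left.1 (hdisj z hz z' hz' hne) (hA1 z hz e he).2.1 (hA1 z' hz' e he').2.1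
  have hAH : Z.biUnion A ⊆ H \ W := by
    intro e he
    obtain ⟨z, hz, he⟩ := Finset.mem_biUnion.1 he
    obtain ⟨h2, h3, h4⟩ := hA1 z hz e he
    refine Finset.mem_sdiff.2 ⟨Finset.mem_filter.2 ⟨?_, ?_, z, hz, h2⟩, ?_⟩
    · refine Finset.mem_product.2 ⟨hD1 (hZ z hz ?_), Finset.mem_univ _⟩
      simp only [mem_box] at h3 ⊢; omega
    · refine hD1 (hZ z hz ?_)
      obtain ⟨⟨a, b⟩, d⟩ := e
      cases d <;> simp [mem_box, Edge.tgt, step] at h3 ⊢ <;> omega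
    · intro h5
      obtain ⟨z', hz', h5⟩ := Finset.mem_biUnion.1 h5
      rw [mem_boxEdges] at h5
      rcases eq_or_ne z z' with rfl | hne
      · exact h4 h5
      · refine Finset.disjoint_left.1 (hdisj z hz z' hz' hne) h3 ?_
        simp only [mem_box] at h5 ⊢; omega
  have hneg : ∀ e ∈ H \ W, v e < 0 := by
    intro e he
    obtain ⟨h2, h3⟩ := Finset.mem_sdiff.1 he
    obtain ⟨-, -, z, hz, h4⟩ := Finset.mem_filter.1 h2
    exact hY2 z hz e h4 fun h => h3 (Finset.mem_biUnion.2 ⟨z, hz, h⟩)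
  have h2 : ∑ e ∈ H, v e ≤ Z.card * K - Z.card * (w - K) := by
    have h3 : ∑ e ∈ H, v e = ∑ e ∈ H ∩ W, v e + ∑ e ∈ H \ W, v e :=
      (Finset.sum_inter_add_sum_sdiff _ _ _).symm
    have h4 : ∑ e ∈ H ∩ W, v e ≤ Z.card * K := by
      calc _ ≤ ∑ e ∈ H ∩ W, |v e| := Finset.sum_le_sum fun e _ => le_abs_self _
        _ ≤ ∑ e ∈ W, |v e| := Finset.sum_le_sum_of_subset_of_nonneg Finset.inter_subset_right
            fun _ _ _ => abs_nonneg _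
        _ ≤ ∑ z ∈ Z, ∑ e ∈ boxEdges z M, |v e| := by
            rw [hW, Finset.sum_biUnion]
            intro z hz z' hz' hne
            rw [Function.onFun, Finset.disjoint_left]
            intro e he he'
            rw [mem_boxEdges] at he he'
            refine Finset.disjoint_left.1 (hdisj z hz z' hz' hne) (?_ : e.1 ∈ _) ?_
            · simp only [mem_box] at he ⊢; omega
            · simp only [mem_box] at he' ⊢; omega
        _ ≤ ∑ z ∈ Z, K := Finset.sum_le_sum hcost
        _ = _ := by simp
    have h5 : Z.card * (w - K) ≤ -∑ e ∈ H \ W, v e := by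
      calc Z.card * (w - K) = ∑ z ∈ Z, (w - K) := by rw [Finset.sum_const, nsmul_eq_mul]
        _ ≤ ∑ z ∈ Z, ∑ e ∈ A z, |v e| := Finset.sum_le_sum hA2
        _ = ∑ e ∈ Z.biUnion A, |v e| := (Finset.sum_biUnion hAdisj).symm
        _ ≤ ∑ e ∈ H \ W, |v e| := Finset.sum_le_sum_of_subset_of_nonneg hAH
            fun _ _ _ => abs_nonneg _
        _ = _ := by
            rw [← Finset.sum_neg_distrib]
            exact Finset.sum_congr rfl fun e he => abs_of_neg (hneg e he)
    linarith
  linarith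

/-! ### Uniqueness of the infinite component -/

/-- Translation of real functions on the edges by `z`. -/
def shift (z : Site) (v : Edge → ℝ) : Edge → ℝ := fun e => v (e.1 - z, e.2)

/-- The properties of the law of the edge values used below: it is translation invariant, the cut
inequality holds, and the absolute values behave like independent copies of an almost surely
positive finite random variable. -/
structure ValueLaw (ν : Measure (Edge → ℝ)) : Prop where
  inv : ∀ z, MeasurePreserving (shift z) ν ν
  cut : ∀ᵐ v ∂ν, CutNonneg v
  large : ∀ ε > 0, ∃ M > 0, ∀ s : Finset Edge,
    ν.real {v | ∀ e ∈ s, |v e| ∈ Set.Ioi M} ≤ ε ^ s.card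
  small : ∀ ε > 0, ∃ c > 0, ∀ s : Finset Edge,
    ν.real {v | ∀ e ∈ s, |v e| ∈ Set.Iic c} ≤ ε ^ s.card

theorem measurableSet_adj (f g : DualSite) : MeasurableSet {v | (unsat v).Adj f g} := by
  have h : {v | (unsat v).Adj f g} = ⋃ e : Edge, {v : Edge → ℝ | v e < 0 ∧ dualEnds e = s(f, g)} := by
    ext v; simp only [unsat, Set.mem_ofPred_eq, Set.mem_iUnion]
  rw [h]
  refine MeasurableSet.iUnion fun e => ?_
  exact (measurable_pi_apply e measurableSet_Iio).inter (MeasurableSet.const _)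

theorem measurableSet_reachable (f g : DualSite) : MeasurableSet {v | (unsat v).Reachable f g} := by
  have h1 : ∀ n : ℕ, ∀ f, MeasurableSet {v | ∃ p : (unsat v).Walk f g, p.length = n} := by
    intro n
    induction n with
    | zero =>
      intro f
      have : {v | ∃ p : (unsat v).Walk f g, p.length = 0} = {_v | f = g} := by
        ext v
        constructor
        · rintro ⟨p, hp⟩; exact SimpleGraph.Walk.eq_of_length_eq_zero hp
        · intro h
          obtain rfl : f = g := h
          exact ⟨SimpleGraph.Walk.nil, rfl⟩
      rw [this]
      exact MeasurableSet.const _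
    | succ n ih =>
      intro f
      have : {v | ∃ p : (unsat v).Walk f g, p.length = n + 1}
          = ⋃ k : DualSite, {v | (unsat v).Adj f k} ∩
            {v | ∃ p : (unsat v).Walk k g, p.length = n} := by
        ext v
        simp only [Set.mem_iUnion, Set.mem_inter_iff, Set.mem_ofPred_eq]
        constructor
        · rintro ⟨p, hp⟩
          cases p with
          | nil => simp at hp
          | cons h p => exact ⟨_, h, p, by simpa using hp⟩
        · rintro ⟨k, h, p, hp⟩
          exact ⟨SimpleGraph.Walk.cons h p, by simpa using hp⟩
      rw [this]
      exact MeasurableSet.iUnion fun k => (measurableSet_adj f k).inter (ih k)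
  have h2 : {v | (unsat v).Reachable f g}
      = ⋃ n : ℕ, {v | ∃ p : (unsat v).Walk f g, p.length = n} := by
    ext v
    simp only [Set.mem_iUnion, Set.mem_ofPred_eq]
    exact ⟨fun ⟨p⟩ => ⟨_, p, rfl⟩, fun ⟨_, p, _⟩ => ⟨p⟩⟩
  rw [h2]
  exact MeasurableSet.iUnion fun n => h1 n f

theorem measurableSet_infComp (f : DualSite) : MeasurableSet {v | InfComp v f} := by
  have h : {v | InfComp v f} = ⋂ s : Finset DualSite, ⋃ g : DualSite,
      {v | (unsat v).Reachable f g} ∩ {_v | g ∉ s} := by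
    ext v
    simp only [Set.mem_iInter, Set.mem_iUnion, Set.mem_inter_iff, Set.mem_ofPred_eq]
    constructor
    · intro h s
      obtain ⟨g, hg, hgs⟩ := Set.Infinite.exists_notMem_finset h s
      exact ⟨g, hg, hgs⟩
    · intro h hfin
      obtain ⟨g, hg, hgs⟩ := h hfin.toFinset
      exact hgs (hfin.mem_toFinset.2 hg)
  rw [h]
  exact MeasurableSet.iInter fun s => MeasurableSet.iUnion fun g =>
    (measurableSet_reachable f g).inter (MeasurableSet.const _)

theorem measurableSet_twoInf (z : Site) (M : ℕ) : MeasurableSet {v | TwoInf v z M} := by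
  have h : {v | TwoInf v z M} = ⋃ f ∈ box z M, ⋃ g ∈ box z M,
      {v | InfComp v f} ∩ ({v | InfComp v g} ∩ {v | (unsat v).Reachable f g}ᶜ) := by
    ext v
    simp only [TwoInf, Set.mem_iUnion, Set.mem_inter_iff, Set.mem_ofPred_eq, Set.mem_compl_iff,
      exists_prop]
  rw [h]
  exact Finset.measurableSet_biUnion _ fun f _ => Finset.measurableSet_biUnion _ fun g _ =>
    (measurableSet_infComp f).inter
      ((measurableSet_infComp g).inter (measurableSet_reachable f g).compl)

/-- Translation is an isomorphism of the graphs of unsatisfied dual edges. -/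
def shiftIso (z : Site) (v : Edge → ℝ) : unsat (shift z v) ≃g unsat v where
  toEquiv := Equiv.subRight z
  map_rel_iff' := by
    intro f g
    simp only [Equiv.subRight_apply, unsat, shift, dualEnds, Sym2.eq_iff]
    constructor
    · rintro ⟨e, he, h⟩
      refine ⟨(e.1 + z, e.2), by simpa using he, ?_⟩
      simp only [add_sub_right_comm]
      rcases h with ⟨h1, h2⟩ | ⟨h1, h2⟩
      · left; rw [h2, h1]; simp
      · right; rw [h2, h1]; simp
    · rintro ⟨e, he, h⟩
      refine ⟨(e.1 - z, e.2), he, ?_⟩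
      simp only [sub_right_comm _ z]
      rcases h with ⟨h1, h2⟩ | ⟨h1, h2⟩
      · left; rw [h2, h1]; simp
      · right; rw [h2, h1]; simp

theorem reachable_shift (z : Site) (v : Edge → ℝ) (f g : DualSite) :
    (unsat (shift z v)).Reachable f g ↔ (unsat v).Reachable (f - z) (g - z) :=
  (SimpleGraph.Iso.reachable_iff (φ := shiftIso z v)).symm

theorem infComp_shift (z : Site) (v : Edge → ℝ) (f : DualSite) :
    InfComp (shift z v) f ↔ InfComp v (f - z) := by
  unfold InfComp
  simp only [reachable_shift]
  exact Set.infinite_coe_iff.symm.trans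
    (((Equiv.subRight z).subtypeEquiv fun g => Iff.rfl).infinite_iff.trans Set.infinite_coe_iff)

theorem sub_mem_box (z x y : Site) (r : ℕ) : x - y ∈ box z r ↔ x ∈ box (z + y) r := by
  simp only [mem_box, Prod.fst_sub, Prod.snd_sub, Prod.fst_add, Prod.snd_add]; omega

theorem twoInf_shift (z : Site) (v : Edge → ℝ) (M : ℕ) : TwoInf (shift z v) z M ↔ TwoInf v 0 M := by
  unfold TwoInf
  simp only [infComp_shift, reachable_shift]
  have hb : ∀ f, f ∈ box z M ↔ f - z ∈ box 0 M := fun f => by rw [sub_mem_box, zero_add]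
  constructor
  · rintro ⟨f, hf, g, hg, h⟩
    exact ⟨f - z, (hb f).1 hf, g - z, (hb g).1 hg, h⟩
  · rintro ⟨f, hf, g, hg, h⟩
    exact ⟨f + z, (hb _).2 (by simpa), g + z, (hb _).2 (by simpa), by simpa using h⟩

variable {ν : Measure (Edge → ℝ)}

theorem ValueLaw.real_twoInf (hν : ValueLaw ν) (z : Site) (M : ℕ) :
    ν.real {v | TwoInf v z M} = ν.real {v | TwoInf v 0 M} := by
  rw [measureReal_def, measureReal_def,
    ← (hν.inv z).measure_preimage (measurableSet_twoInf z M).nullMeasurableSet]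
  congr 2
  ext v
  exact twoInf_shift z v M

/-- The total weight near a site is tight, uniformly in the site. -/
theorem ValueLaw.exists_cost [IsFiniteMeasure ν] (hν : ValueLaw ν) (M : ℕ) {ε : ℝ} (hε : 0 < ε) :
    ∃ K, ∀ z, ν.real {v | ¬ ∑ e ∈ boxEdges z M, |v e| ≤ K} ≤ ε := by
  have hcard : ∀ z, (boxEdges z M).card = (2 * M + 1) ^ 2 * 2 := fun z => by
    simp [boxEdges, card_box]
  set n : ℕ := (2 * M + 1) ^ 2 * 2 with hn
  have hn0 : (0 : ℝ) < n := by positivity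
  obtain ⟨K, hK, h⟩ := hν.large (ε / n) (by positivity)
  refine ⟨n * K, fun z => ?_⟩
  have hsub : {v : Edge → ℝ | ¬ ∑ e ∈ boxEdges z M, |v e| ≤ n * K} ⊆
      ⋃ e ∈ boxEdges z M, {v | ∀ e' ∈ ({e} : Finset Edge), |v e'| ∈ Set.Ioi K} := by
    intro v hv
    by_contra hcon
    simp only [Set.mem_iUnion, Set.mem_ofPred_eq, Set.mem_Ioi,
      not_exists, not_lt, Finset.mem_singleton, forall_eq] at hcon
    refine hv ((Finset.sum_le_sum hcon).trans ?_)
    rw [Finset.sum_const, nsmul_eq_mul, hcard]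
  refine (measureReal_mono hsub (measure_ne_top _ _)).trans
    ((measureReal_biUnion_finset_le _ _).trans ?_)
  calc _ ≤ ∑ e ∈ boxEdges z M, (ε / n) ^ 1 := Finset.sum_le_sum fun e _ => by
        simpa using h {e}
    _ = ε := by
        rw [Finset.sum_const, nsmul_eq_mul, hcard, pow_one]
        field_simp

theorem sq_mul_pow_le (m : ℕ) : (2 * (m : ℝ) + 1) ^ 2 * (1 / 16) ^ m ≤ 4 * (1 / 4) ^ m := by
  have h : (2 * (m : ℝ) + 1) ^ 2 ≤ 4 * 4 ^ m := by
    have h1 : (m : ℝ) + 1 ≤ 2 ^ m := by exact_mod_cast Nat.lt_two_pow_self (n := m)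
    calc (2 * (m : ℝ) + 1) ^ 2 ≤ (2 * 2 ^ m) ^ 2 := by gcongr; linarith
      _ = _ := by rw [mul_pow, ← pow_mul, mul_comm m 2, pow_mul]; norm_num
  calc _ ≤ 4 * 4 ^ m * (1 / 16 : ℝ) ^ m := by gcongr
    _ = _ := by rw [mul_assoc, ← mul_pow]; norm_num

theorem exists_pow_le {r : ℝ} (h0 : 0 ≤ r) (h1 : r < 1) (C : ℝ) {ε : ℝ} (hε : 0 < ε) :
    ∃ n₀ : ℕ, ∀ n ≥ n₀, C * r ^ n ≤ ε := by
  have h := (tendsto_pow_atTop_nhds_zero_of_lt_one h0 h1).const_mul C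
  rw [mul_zero] at h
  exact Filter.eventually_atTop.1 (h.eventually_le_const hε)

/-- Enclosing contours of weight `s m` exist with probability close to one. -/
theorem ValueLaw.exists_enclosed [IsFiniteMeasure ν] (hν : ValueLaw ν) {ε : ℝ} (hε : 0 < ε) :
    ∃ s > 0, ∃ n₀ : ℕ, ∀ n ≥ n₀, ν.real {v | ¬ Enclosed v 0 n s} ≤ ε := by
  obtain ⟨M, hM, h⟩ := hν.large (1 / 64) (by norm_num)
  obtain ⟨n₀, hn₀⟩ := exists_pow_le (r := 1 / 4) (by norm_num) (by norm_num) 4 (half_pos hε)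
  refine ⟨112 * M / min 1 (ε / 2), by positivity, max n₀ 1, fun n hn => ?_⟩
  have hn1 : n₀ ≤ n := (le_max_left _ _).trans hn
  have hn2 : 1 ≤ n := (le_max_right _ _).trans hn
  have hmin : 0 < min 1 (ε / 2) := by positivity
  refine (real_not_enclosed_le hM h hn2 (by positivity) 0).trans ?_
  have h1 : (112 * M / (112 * M / min 1 (ε / 2))) ^ 2 ≤ ε / 2 := by
    rw [div_div_cancel₀ (by positivity)]
    calc (min 1 (ε / 2)) ^ 2 ≤ (min 1 (ε / 2)) ^ 1 :=
          pow_le_pow_of_le_one hmin.le (min_le_left _ _) (by norm_num)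
      _ ≤ ε / 2 := by rw [pow_one]; exact min_le_right _ _
  have h2 := (sq_mul_pow_le n).trans (hn₀ n hn1)
  linarith

/-- Every path of `2 k` dual edges started in a box has weight at least `c k`, except with
exponentially small probability. -/
theorem ValueLaw.exists_weight [IsFiniteMeasure ν] (hν : ValueLaw ν) :
    ∃ c > 0, ∀ (z : Site) (r k : ℕ), ν.real {v | ¬ ∀ f ∈ box z r,
      ∀ l ∈ pathLists dualMove (2 * k) f, l.Nodup → c * k ≤ ∑ e ∈ l.toFinset, |v e|}
        ≤ (2 * r + 1) ^ 2 * (1 / 2) ^ k := by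
  obtain ⟨c, hc, h⟩ := hν.small (1 / 128) (by norm_num)
  refine ⟨c, hc, fun z r k => ?_⟩
  have hsub : {v : Edge → ℝ | ¬ ∀ f ∈ box z r,
      ∀ l ∈ pathLists dualMove (2 * k) f, l.Nodup → c * k ≤ ∑ e ∈ l.toFinset, |v e|} ⊆
      ⋃ f ∈ box z r, {v | ∃ l ∈ pathLists dualMove (2 * k) f, l.Nodup ∧
        ∑ e ∈ l.toFinset, |v e| < c * k} := by
    intro v hv
    simp only [Set.mem_ofPred_eq] at hv
    push Not at hv
    obtain ⟨f, hf, hl⟩ := hv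
    exact Set.mem_biUnion hf hl
  refine (measureReal_mono hsub (measure_ne_top _ _)).trans
    ((measureReal_biUnion_finset_le _ _).trans ?_)
  calc _ ≤ ∑ f ∈ box z r, (64 * (1 / 128) : ℝ) ^ k :=
        Finset.sum_le_sum fun f _ => real_exists_light_le hc.le h _ _ _
    _ = _ := by
        rw [Finset.sum_const, nsmul_eq_mul, card_box]; norm_num

/-- Almost surely there are no two infinite components near the origin. Otherwise there would be
`≈ n²` well separated places in a box of radius `≈ n` where joining two infinite components pays
off, but the energy gain in that box is at most of order `n`. -/
theorem ValueLaw.real_twoInf_eq_zero [IsProbabilityMeasure ν] (hν : ValueLaw ν) (M : ℕ) :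
    ν.real {v | TwoInf v 0 M} = 0 := by
  classical
  by_contra hne
  set a := ν.real {v | TwoInf v 0 M} with ha
  have ha0 : 0 < a := lt_of_le_of_ne measureReal_nonneg (Ne.symm hne)
  obtain ⟨K, hK⟩ := hν.exists_cost M (ε := a / 4) (by positivity)
  obtain ⟨c, hc, hw⟩ := hν.exists_weight
  obtain ⟨k₀, hk₀⟩ := exists_pow_le (r := 1 / 2) (by norm_num) (by norm_num)
    ((2 * M + 1 : ℝ) ^ 2) (ε := a / 4) (by positivity)
  obtain ⟨k₁, hk₁⟩ := exists_nat_ge ((2 * K + 1) / c)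
  set k := max k₀ k₁ with hk
  have hgain : 1 ≤ c * k - 2 * K := by
    have h1 : (2 * K + 1) / c ≤ k := hk₁.trans (by exact_mod_cast le_max_right _ _)
    rw [div_le_iff₀ hc] at h1
    linarith
  obtain ⟨s, hs, n₀, hn₀⟩ := hν.exists_enclosed (ε := a / 4) (by positivity)
  set L : ℕ := 2 * (M + 2 * k) + 1 with hL
  obtain ⟨n₁, hn₁⟩ := exists_nat_gt (8 * s * L / a)
  set n := max (max n₀ n₁) 1 with hn
  have hnn₀ : n₀ ≤ L * n := by
    have h1 : n₀ ≤ n := (le_max_left _ _).trans (le_max_left _ _)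
    nlinarith
  -- The places are the points of a square lattice of spacing `L`.
  set Λ : Finset Site :=
    (Finset.range n ×ˢ Finset.range n).image fun p => ((L * p.1 : ℕ), (L * p.2 : ℕ)) with hΛ
  have hL0 : L ≠ 0 := by omega
  have hcard : Λ.card = n ^ 2 := by
    rw [hΛ, Finset.card_image_of_injective, Finset.card_product, Finset.card_range, sq]
    rintro ⟨p, q⟩ ⟨p', q'⟩ h
    simp only [Prod.mk.injEq, Nat.cast_inj, mul_right_inj' hL0] at h
    exact Prod.ext h.1 h.2
  have hbox : ∀ z ∈ Λ, box z (M + 2 * k + 1) ⊆ box 0 (L * n) := by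
    intro z hz x hx
    obtain ⟨⟨p, q⟩, hpq, rfl⟩ := Finset.mem_image.1 hz
    simp only [Finset.mem_product, Finset.mem_range] at hpq
    have h1 : L * (p + 1) ≤ L * n := Nat.mul_le_mul_left _ hpq.1
    have h2 : L * (q + 1) ≤ L * n := Nat.mul_le_mul_left _ hpq.2
    rw [mul_add] at h1 h2
    generalize L * n = A at *
    generalize L * p = B at *
    generalize L * q = C at *
    simp only [mem_box, Prod.fst_zero, Prod.snd_zero] at hx ⊢
    omega
  have hdisj : ∀ z ∈ Λ, ∀ z' ∈ Λ, z ≠ z' →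
      Disjoint (box z (M + 2 * k)) (box z' (M + 2 * k)) := by
    intro z hz z' hz' hne
    obtain ⟨⟨p, q⟩, -, rfl⟩ := Finset.mem_image.1 hz
    obtain ⟨⟨p', q'⟩, -, rfl⟩ := Finset.mem_image.1 hz'
    rw [Finset.disjoint_left]
    intro x hx hx'
    simp only [mem_box] at hx hx'
    have hsep : ∀ i j : ℕ, i ≠ j → L * i + L ≤ L * j ∨ L * j + L ≤ L * i := by
      intro i j hij
      rcases lt_or_gt_of_ne hij with h | h
      · left; have := Nat.mul_le_mul_left L (Nat.succ_le_of_lt h); rwa [Nat.mul_succ] at this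
      · right; have := Nat.mul_le_mul_left L (Nat.succ_le_of_lt h); rwa [Nat.mul_succ] at this
    by_cases hp : p = p'
    · by_cases hq : q = q'
      · exact hne (by rw [hp, hq])
      · have := hsep q q' hq
        omega
    · have := hsep p p' hp
      omega
  -- The good event at `z`, made measurable.
  set G : Site → Set (Edge → ℝ) := fun z => {v | TwoInf v z M} \ toMeasurable ν
    ({v | ¬ ∑ e ∈ boxEdges z M, |v e| ≤ K} ∪ {v | ¬ ∀ f ∈ box z M,
      ∀ l ∈ pathLists dualMove (2 * k) f, l.Nodup → c * k ≤ ∑ e ∈ l.toFinset, |v e|}) with hG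
  have hGm : ∀ z, MeasurableSet (G z) := fun z =>
    (measurableSet_twoInf z M).diff (measurableSet_toMeasurable _ _)
  have hGr : ∀ z, a / 2 ≤ ν.real (G z) := by
    intro z
    have h1 : a ≤ ν.real (G z) + ν.real (toMeasurable ν
        ({v | ¬ ∑ e ∈ boxEdges z M, |v e| ≤ K} ∪ {v | ¬ ∀ f ∈ box z M,
          ∀ l ∈ pathLists dualMove (2 * k) f, l.Nodup → c * k ≤ ∑ e ∈ l.toFinset, |v e|})) := by
      rw [ha, ← hν.real_twoInf z M]
      refine (measureReal_mono ?_ (measure_ne_top _ _)).trans (measureReal_union_le _ _)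
      rw [hG, Set.sdiff_union_self]
      exact Set.subset_union_left
    rw [measureReal_def, measureReal_def, measure_toMeasurable, ← measureReal_def,
      ← measureReal_def] at h1
    have h2 := measureReal_union_le (μ := ν) {v | ¬ ∑ e ∈ boxEdges z M, |v e| ≤ K}
      {v | ¬ ∀ f ∈ box z M, ∀ l ∈ pathLists dualMove (2 * k) f, l.Nodup →
        c * k ≤ ∑ e ∈ l.toFinset, |v e|}
    have h3 := (hw z M k).trans (hk₀ k (le_max_left _ _))
    linarith [hK z]
  set B : Set (Edge → ℝ) := toMeasurable ν {v | ¬ Enclosed v 0 (L * n) s} with hB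
  have hBr : ν.real B ≤ a / 4 := by
    rw [hB, measureReal_def, measure_toMeasurable, ← measureReal_def]
    exact hn₀ _ hnn₀
  have hpt : ∀ᵐ v ∂ν, ∑ z ∈ Λ, (G z).indicator (1 : (Edge → ℝ) → ℝ) v ≤
      2 * (s * (L * n)) + n ^ 2 * B.indicator (1 : (Edge → ℝ) → ℝ) v := by
    filter_upwards [hν.cut] with v hv
    have hsum : ∑ z ∈ Λ, (G z).indicator (1 : (Edge → ℝ) → ℝ) v
        = (Λ.filter fun z => v ∈ G z).card := by
      simp only [Set.indicator_apply, Pi.one_apply, Finset.card_filter]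
      push_cast
      rfl
    rw [hsum]
    by_cases hvB : v ∈ B
    · have h1 : ((Λ.filter fun z => v ∈ G z).card : ℝ) ≤ n ^ 2 := by
        rw [← Nat.cast_pow, ← hcard]
        exact_mod_cast Finset.card_filter_le _ _
      rw [Set.indicator_of_mem hvB]
      have h2 : (0 : ℝ) ≤ 2 * (s * (L * n)) := by positivity
      simp only [Pi.one_apply]
      linarith
    · rw [Set.indicator_of_notMem hvB]
      have henc : Enclosed v 0 (L * n) s := by
        by_contra h
        exact hvB (subset_toMeasurable _ _ h)
      have hgood : ∀ z ∈ Λ.filter fun z => v ∈ G z, TwoInf v z M ∧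
          (∑ e ∈ boxEdges z M, |v e| ≤ K) ∧ ∀ f ∈ box z M,
            ∀ l ∈ pathLists dualMove (2 * k) f, l.Nodup → c * k ≤ ∑ e ∈ l.toFinset, |v e| := by
        intro z hz
        obtain ⟨h1, h2⟩ := (Finset.mem_filter.1 hz).2
        have h3 := fun h => h2 (subset_toMeasurable _ _ h)
        simp only [Set.mem_union, Set.mem_ofPred_eq] at h3
        exact ⟨h1, by_contra fun h => h3 (Or.inl h), by_contra fun h => h3 (Or.inr h)⟩
      have h4 := hv.card_mul_le (Z := Λ.filter fun z => v ∈ G z) (w := c * k) (K := K)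
        (fun z hz => hbox z (Finset.mem_filter.1 hz).1)
        (fun z hz z' hz' => hdisj z (Finset.mem_filter.1 hz).1 z' (Finset.mem_filter.1 hz').1)
        (fun z hz => (hgood z hz).1) (fun z hz => (hgood z hz).2.1)
        (fun z hz => (hgood z hz).2.2) henc
      push_cast at h4
      have h5 : ((Λ.filter fun z => v ∈ G z).card : ℝ) * 1
          ≤ (Λ.filter fun z => v ∈ G z).card * (c * k - 2 * K) := by gcongr
      linarith
  have hindint : ∀ S : Set (Edge → ℝ), MeasurableSet S →
      Integrable (S.indicator (1 : (Edge → ℝ) → ℝ)) ν := fun S hS =>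
    (integrable_const (1 : ℝ)).indicator hS
  have hBm : MeasurableSet B := measurableSet_toMeasurable _ _
  have hint := integral_mono_ae (integrable_finsetSum Λ fun z _ => hindint _ (hGm z))
    ((integrable_const (2 * (s * (L * n)))).add ((hindint B hBm).const_mul (n ^ 2 : ℝ))) hpt
  rw [integral_finsetSum _ fun z _ => hindint _ (hGm z),
    integral_add' (integrable_const _) ((hindint B hBm).const_mul _), integral_const,
    integral_const_mul, integral_indicator_one hBm] at hint
  simp only [integral_indicator_one (hGm _), probReal_univ, smul_eq_mul, one_mul] at hint
  have h1 : (n : ℝ) ^ 2 * (a / 2) ≤ ∑ z ∈ Λ, ν.real (G z) := by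
    calc (n : ℝ) ^ 2 * (a / 2) = ∑ z ∈ Λ, a / 2 := by
          rw [Finset.sum_const, nsmul_eq_mul, hcard]; push_cast; ring
      _ ≤ _ := Finset.sum_le_sum fun z _ => hGr z
  have hn1 : (1 : ℝ) ≤ n := by exact_mod_cast le_max_right _ _
  have h2 : (n : ℝ) ^ 2 * ν.real B ≤ n ^ 2 * (a / 4) := by gcongr
  have h3 : 8 * s * L / a < n := hn₁.trans_le (by
    exact_mod_cast (le_max_right n₀ n₁).trans (le_max_left _ _))
  rw [div_lt_iff₀ ha0] at h3
  nlinarith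

/-- Almost surely, any two infinite components coincide. -/
theorem ValueLaw.ae_reachable [IsProbabilityMeasure ν] (hν : ValueLaw ν) :
    ∀ᵐ v ∂ν, ∀ f g, InfComp v f → InfComp v g → (unsat v).Reachable f g := by
  have h1 : ∀ᵐ v ∂ν, ∀ M : ℕ, ¬ TwoInf v 0 M := by
    rw [ae_all_iff]
    intro M
    have := hν.real_twoInf_eq_zero M
    rw [measureReal_eq_zero_iff] at this
    exact measure_eq_zero_iff_ae_notMem.1 this
  filter_upwards [h1] with v hv f g hf hg
  by_contra h
  obtain ⟨r, hr⟩ := exists_box_of_finset {f, g}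
  exact hv r ⟨f, hr (by simp), g, hr (by simp), hf, hg, h⟩

/-! ### A unique infinite component is impossible -/

/-- Paths of unsatisfied dual edges between two dual sites of a box stay near the box: otherwise
flipping the spins between the path and a short-cut in the box, outside of the region that encloses
the box, would lower the energy. -/
theorem CutNonneg.mem_box_of_enclosed {v : Edge → ℝ} (hv : CutNonneg v) {z : Site} {m k : ℕ}
    {w s : ℝ} (henc : Enclosed v z (3 * m) s) (hw : s * (3 * m : ℕ) < w)
    (hgain : ∀ f ∈ box z (6 * m + k + 2), ∀ l ∈ pathLists dualMove k f, l.Nodup →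
      w ≤ ∑ e ∈ l.toFinset, |v e|)
    {f g : DualSite} (hf : f ∈ box z (2 * m)) (hg : g ∈ box z (2 * m)) {p : (unsat v).Walk f g}
    (hp : p.IsPath) {h : DualSite} (hh : h ∈ p.support) : h ∈ box z (6 * m + k + 1) := by
  classical
  by_contra hcon
  obtain ⟨D, hD1, hD2, hD3⟩ := henc
  -- A point of the path just outside the box.
  obtain ⟨h', hh', h1, h2⟩ : ∃ h' ∈ p.support, h' ∈ box z (6 * m + k + 2) ∧
      h' ∉ box z (6 * m + k + 1) := by
    obtain ⟨d, hd, hd1, hd2⟩ := (p.takeUntil h hh).exists_boundary_dart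
      (box z (6 * m + k + 1) : Set Site) (by
        rw [Finset.mem_coe]; simp only [mem_box] at hf ⊢; omega) (by simpa using hcon)
    refine ⟨d.snd, p.support_takeUntil_subset_support hh
      ((p.takeUntil h hh).dart_snd_mem_support_of_mem_darts hd), ?_, by simpa using hd2⟩
    have h3 := unsat_adj_mem_box _ _ d.adj
    rw [Finset.mem_coe] at hd1
    simp only [mem_box] at h3 hd1 ⊢
    omega
  have hq : (p.dropUntil h' hh').IsPath := hp.dropUntil hh'
  have hk : k ≤ (p.dropUntil h' hh').length := by
    have h3 := mem_box_length unsat_adj_mem_box (p.dropUntil h' hh')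
    by_contra hlt
    apply h2
    simp only [mem_box] at h3 hg ⊢
    omega
  obtain ⟨l, hl, hnd, hlp⟩ := exists_dualList hq hk
  have hgain' := hgain h' h1 l hl hnd
  have hlp' : ∀ e ∈ l, dualEnds e ∈ p.edges := fun e he =>
    p.edges_dropUntil_subset_edges hh' (hlp e he)
  have hfar : ∀ e ∈ l, e.src ∉ D ∧ e.tgt ∉ D := by
    intro e he
    have h3 := mem_box_of_mem_pathLists hl he
    have h4 : e.1 ∉ box z (6 * m + 1) := by
      intro h4
      apply h2
      simp only [mem_box] at h3 h4 ⊢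
      omega
    constructor
    · intro h5
      apply h4
      have := hD2 h5
      simp only [mem_box, Edge.src] at this ⊢
      omega
    · intro h5
      apply h4
      have := hD2 h5
      obtain ⟨⟨a, b⟩, d⟩ := e
      cases d <;> simp [mem_box, Edge.tgt, step] at this ⊢ <;> omega
  obtain ⟨X, hX1, hX2⟩ := exists_chain_box hf hg
  have hbD : ∀ e ∈ boxEdges z (2 * m), e.src ∈ D := by
    intro e he
    refine hD1 ?_
    rw [mem_boxEdges] at he
    simp only [mem_box, Edge.src] at he ⊢
    omega
  have hX0 : ∀ e, e.src ∉ D → X e = 0 := fun e he => by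
    by_contra h; exact he (hbD e (hX1 e h))
  obtain ⟨r, hr⟩ := exists_box_of_finset (p.support.toFinset ∪ box z (2 * m))
  obtain ⟨C, hC⟩ := exists_edgeBoundary (walkChain p + X) r (by
      intro e he
      apply hr
      by_cases h3 : dualEnds e ∈ p.edges
      · exact Finset.mem_union_left _ (List.mem_toFinset.2 (p.fst_mem_support_of_mem_edges h3))
      · refine Finset.mem_union_right _ (mem_boxEdges.1 (hX1 e fun h4 => he ?_))
        simp [walkChain_eq_zero h3, h4])
    (fun h => by
      rw [div_add, div_walkChain, hX2]
      split_ifs <;> decide)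
  set I := (edgeBoundary C).filter fun e => e.src ∉ D ∧ e.tgt ∉ D with hI
  have hpath : ∀ e, e.src ∉ D → ((walkChain p + X) e = 1 ↔ dualEnds e ∈ p.edges) := by
    intro e he
    rw [Pi.add_apply, hX0 e he, add_zero, walkChain_eq_one_iff hp.isTrail.edges_nodup]
  have h3 := hv.neg_sum_le (C \ D) I (edgeBoundary D)
    (fun e he heD => by
      rw [mem_edgeBoundary] at he heD
      rw [hI, Finset.mem_filter, mem_edgeBoundary]
      simp only [Finset.mem_sdiff] at he
      grind)
    (fun e he => by
      rw [hI, Finset.mem_filter, mem_edgeBoundary] at he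
      rw [mem_edgeBoundary]
      simp only [Finset.mem_sdiff]
      grind)
  have hneg : ∀ e ∈ I, v e < 0 := by
    intro e he
    obtain ⟨h4, h5, -⟩ := Finset.mem_filter.1 he
    exact neg_of_mem_edges ((hpath e h5).1 ((hC e).1 h4))
  have h4 : ∑ e ∈ l.toFinset, |v e| ≤ -∑ e ∈ I, v e := by
    rw [← Finset.sum_neg_distrib, ← Finset.sum_congr rfl fun e he => abs_of_neg (hneg e he)]
    refine Finset.sum_le_sum_of_subset_of_nonneg (fun e he => ?_) fun _ _ _ => abs_nonneg _
    rw [List.mem_toFinset] at he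
    exact Finset.mem_filter.2 ⟨(hC e).2 ((hpath e (hfar e he).1).2 (hlp' e he)), hfar e he⟩
  linarith

/-- `f` and `g` are joined by a walk in `G` whose vertices satisfy `P`. -/
def JoinedIn (G : SimpleGraph DualSite) (P : DualSite → Prop) (f g : DualSite) : Prop :=
  ∃ p : G.Walk f g, ∀ h ∈ p.support, P h

theorem JoinedIn.trans {G : SimpleGraph DualSite} {P : DualSite → Prop} {f g h : DualSite}
    (h1 : JoinedIn G P f g) (h2 : JoinedIn G P g h) : JoinedIn G P f h := by
  obtain ⟨p, hp⟩ := h1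
  obtain ⟨q, hq⟩ := h2
  refine ⟨p.append q, fun x hx => ?_⟩
  rcases (SimpleGraph.Walk.mem_support_append_iff _ _).1 hx with hx | hx
  · exact hp x hx
  · exact hq x hx

theorem JoinedIn.symm {G : SimpleGraph DualSite} {P : DualSite → Prop} {f g : DualSite}
    (h1 : JoinedIn G P f g) : JoinedIn G P g f := by
  obtain ⟨p, hp⟩ := h1
  exact ⟨p.reverse, fun x hx => hp x (by simpa using hx)⟩

/-- A forest contains no closed walk around the origin: the walk through the upper, left and lower
half planes does not cross the half line to the right of the origin, but the one through the right
half plane does. -/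
theorem not_surrounded {v : Edge → ℝ} (hac : (unsat v).IsAcyclic) {ne nw sw se : DualSite}
    (h1 : JoinedIn (unsat v) (fun h => 0 ≤ h.2) ne nw)
    (h2 : JoinedIn (unsat v) (fun h => h.1 < 0) nw sw)
    (h3 : JoinedIn (unsat v) (fun h => h.2 < 0) sw se)
    (h4 : JoinedIn (unsat v) (fun h => 0 ≤ h.1) ne se) : False := by
  classical
  have hne : 0 ≤ ne.2 := by
    obtain ⟨p, hp⟩ := h1; exact hp _ p.start_mem_support
  have hse : se.2 < 0 := by
    obtain ⟨p, hp⟩ := h3; exact hp _ p.end_mem_support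
  obtain ⟨p1, hp1⟩ := h1
  obtain ⟨p2, hp2⟩ := h2
  obtain ⟨p3, hp3⟩ := h3
  obtain ⟨q, hq⟩ := h4
  set p := (p1.append p2).append p3 with hp
  have heq : p.bypass = q.bypass := by
    have := (hac.subsingleton_path ne se).elim ⟨p.bypass, p.bypass_isPath⟩
      ⟨q.bypass, q.bypass_isPath⟩
    exact congrArg Subtype.val this
  obtain ⟨d, hd, hd1, hd2⟩ := q.bypass.exists_boundary_dart {h : DualSite | 0 ≤ h.2} hne
    (by simpa using hse)
  simp only [Set.mem_ofPred_eq, not_le] at hd1 hd2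
  have ha : 0 ≤ d.fst.1 := hq _ (q.support_bypass_subset_support
    (q.bypass.dart_fst_mem_support_of_mem_darts hd))
  have hmem : s(d.fst, d.snd) ∈ p.edges := by
    apply p.edges_bypass_subset_edges
    rw [heq]
    exact List.mem_map_of_mem (f := SimpleGraph.Dart.edge) hd
  simp only [hp, SimpleGraph.Walk.edges_append, List.mem_append] at hmem
  rcases hmem with (hm | hm) | hm
  · exact absurd (hp1 _ (p1.snd_mem_support_of_mem_edges hm)) (not_le.2 hd2)
  · exact absurd (hp2 _ (p2.fst_mem_support_of_mem_edges hm)) (not_lt.2 ha)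
  · exact absurd (hp3 _ (p3.fst_mem_support_of_mem_edges hm)) (not_lt.2 hd1)

theorem joinedIn_of_chain {G : SimpleGraph DualSite} {P : DualSite → Prop} (u : ℤ → DualSite)
    (Λ : ℕ) (h : ∀ j : ℤ, -Λ ≤ j → j < Λ → JoinedIn G P (u j) (u (j + 1)))
    (h0 : P (u (-Λ))) : JoinedIn G P (u (-Λ)) (u Λ) := by
  have key : ∀ j : ℤ, -Λ ≤ j → j ≤ Λ → JoinedIn G P (u (-Λ)) (u j) := by
    intro j hj
    induction j, hj using Int.leInduction with
    | base => exact fun _ => ⟨SimpleGraph.Walk.nil, by simpa using h0⟩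
    | succ j hj ih => exact fun hj' => (ih (by omega)).trans (h j hj (by omega))
  exact key Λ (by omega) le_rfl

/-- The centres of the blocks of radius `m` along the boundary of the box of radius `Λ m`. -/
noncomputable def ring (Λ m : ℕ) : Finset Site :=
  (Finset.Icc (-(Λ : ℤ)) Λ).image (fun j => ((Λ * m : ℤ), j * m)) ∪
  (Finset.Icc (-(Λ : ℤ)) Λ).image (fun j => (-(Λ * m : ℤ), j * m)) ∪
  ((Finset.Icc (-(Λ : ℤ)) Λ).image (fun j => (j * m, (Λ * m : ℤ))) ∪
  (Finset.Icc (-(Λ : ℤ)) Λ).image (fun j => (j * m, -(Λ * m : ℤ))))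

theorem card_ring_le (Λ m : ℕ) : (ring Λ m).card ≤ 4 * (2 * Λ + 1) := by
  have h : ∀ f : ℤ → Site, ((Finset.Icc (-(Λ : ℤ)) Λ).image f).card ≤ 2 * Λ + 1 := fun f => by
    refine Finset.card_image_le.trans (le_of_eq ?_)
    rw [Int.card_Icc]; omega
  refine (Finset.card_union_le _ _).trans ?_
  refine (add_le_add (Finset.card_union_le _ _) (Finset.card_union_le _ _)).trans ?_
  have := h (fun j => ((Λ * m : ℤ), j * m))
  have := h (fun j => (-(Λ * m : ℤ), j * m))
  have := h (fun j => (j * m, (Λ * m : ℤ)))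
  have := h (fun j => (j * m, -(Λ * m : ℤ)))
  omega

/-- If there is just one infinite component, and it meets all blocks of a ring, then the paths
between neighbouring blocks, which stay near the blocks, form a closed walk around the origin. -/
theorem CutNonneg.false_of_ring {v : Edge → ℝ} (hv : CutNonneg v)
    (huniq : ∀ f g, InfComp v f → InfComp v g → (unsat v).Reachable f g) {Λ m k : ℕ} (hm : 1 ≤ m)
    (hΛ : 6 * m + k + 2 ≤ Λ * m) {w s : ℝ} (hw : s * (3 * m : ℕ) < w)
    (hinf : ∀ z ∈ ring Λ m, ∃ u ∈ box z m, InfComp v u)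
    (henc : ∀ z ∈ ring Λ m, Enclosed v z (3 * m) s)
    (hgain : ∀ z ∈ ring Λ m, ∀ f ∈ box z (6 * m + k + 2), ∀ l ∈ pathLists dualMove k f, l.Nodup →
      w ≤ ∑ e ∈ l.toFinset, |v e|) : False := by
  choose! u hu1 hu2 using hinf
  have hjoin : ∀ (P : DualSite → Prop) (z z' : Site), z ∈ ring Λ m → z' ∈ ring Λ m →
      z' ∈ box z m → (∀ h ∈ box z (6 * m + k + 1), P h) → JoinedIn (unsat v) P (u z) (u z') := by
    intro P z z' hz hz' hzz hP
    obtain ⟨p, hp⟩ := (huniq _ _ (hu2 z hz) (hu2 z' hz')).exists_isPath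
    refine ⟨p, fun h hh => hP h ?_⟩
    have h1 := hu1 z hz
    have h2 := hu1 z' hz'
    refine hv.mem_box_of_enclosed (henc z hz) hw (hgain z hz) ?_ ?_ hp hh
    · simp only [mem_box] at h1 ⊢; omega
    · simp only [mem_box] at h2 hzz ⊢; omega
  have hside : ∀ (P : DualSite → Prop) (γ : ℤ → Site),
      (∀ j : ℤ, -Λ ≤ j → j ≤ Λ → γ j ∈ ring Λ m ∧ ∀ h ∈ box (γ j) (6 * m + k + 1), P h) →
      (∀ j, γ (j + 1) ∈ box (γ j) m) →
      JoinedIn (unsat v) P (u (γ (-Λ))) (u (γ Λ)) := by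
    intro P γ h1 h2
    refine joinedIn_of_chain (fun j => u (γ j)) Λ (fun j hj hj' => ?_) ?_
    · exact hjoin P _ _ (h1 j hj hj'.le).1 (h1 (j + 1) (by omega) (by omega)).1 (h2 j)
        (h1 j hj hj'.le).2
    · obtain ⟨h3, h4⟩ := h1 (-Λ) le_rfl (by omega)
      refine h4 _ ?_
      have := hu1 _ h3
      simp only [mem_box] at this ⊢
      omega
  have hn : ((6 * m + k + 2 : ℕ) : ℤ) ≤ Λ * m := by exact_mod_cast hΛ
  have hmul : ∀ j : ℤ, (j + 1) * m = j * m + m := fun j => by ring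
  have hneg : (-(Λ : ℤ)) * m = -(Λ * m : ℤ) := by ring
  have hright := hside (fun h => 0 ≤ h.1) (fun j => ((Λ * m : ℤ), j * m))
    (fun j h1 h2 => ⟨by
      refine Finset.mem_union_left _ (Finset.mem_union_left _ (Finset.mem_image_of_mem _ ?_))
      exact Finset.mem_Icc.2 ⟨h1, h2⟩, fun h hh => by simp only [mem_box] at hh ⊢; omega⟩)
    (fun j => by simp only [mem_box, hmul]; omega)
  have hleft := hside (fun h => h.1 < 0) (fun j => (-(Λ * m : ℤ), j * m))
    (fun j h1 h2 => ⟨by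
      refine Finset.mem_union_left _ (Finset.mem_union_right _ (Finset.mem_image_of_mem _ ?_))
      exact Finset.mem_Icc.2 ⟨h1, h2⟩, fun h hh => by simp only [mem_box] at hh ⊢; omega⟩)
    (fun j => by simp only [mem_box, hmul]; omega)
  have hup := hside (fun h => 0 ≤ h.2) (fun j => (j * m, (Λ * m : ℤ)))
    (fun j h1 h2 => ⟨by
      refine Finset.mem_union_right _ (Finset.mem_union_left _ (Finset.mem_image_of_mem _ ?_))
      exact Finset.mem_Icc.2 ⟨h1, h2⟩, fun h hh => by simp only [mem_box] at hh ⊢; omega⟩)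
    (fun j => by simp only [mem_box, hmul]; omega)
  have hdown := hside (fun h => h.2 < 0) (fun j => (j * m, -(Λ * m : ℤ)))
    (fun j h1 h2 => ⟨by
      refine Finset.mem_union_right _ (Finset.mem_union_right _ (Finset.mem_image_of_mem _ ?_))
      exact Finset.mem_Icc.2 ⟨h1, h2⟩, fun h hh => by simp only [mem_box] at hh ⊢; omega⟩)
    (fun j => by simp only [mem_box, hmul]; omega)
  simp only [hneg] at hright hleft hup hdown
  exact not_surrounded hv.isAcyclic hup.symm hleft.symm hdown hright.symm

/-- There is an infinite component, but none that meets the box of radius `m` around `z`. -/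
def Missed (v : Edge → ℝ) (z : Site) (m : ℕ) : Prop :=
  (∃ f, InfComp v f) ∧ ∀ u ∈ box z m, ¬ InfComp v u

theorem measurableSet_missed (z : Site) (m : ℕ) : MeasurableSet {v | Missed v z m} := by
  have h : {v | Missed v z m} = (⋃ f, {v | InfComp v f}) ∩ ⋂ u ∈ box z m, {v | InfComp v u}ᶜ := by
    ext v
    simp only [Missed, Set.mem_inter_iff, Set.mem_iUnion, Set.mem_iInter, Set.mem_ofPred_eq,
      Set.mem_compl_iff]
  rw [h]
  exact (MeasurableSet.iUnion measurableSet_infComp).inter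
    (Finset.measurableSet_biInter _ fun u _ => (measurableSet_infComp u).compl)

theorem missed_shift (z : Site) (v : Edge → ℝ) (m : ℕ) : Missed (shift z v) z m ↔ Missed v 0 m := by
  unfold Missed
  simp only [infComp_shift]
  have hb : ∀ f, f ∈ box z m ↔ f - z ∈ box 0 m := fun f => by rw [sub_mem_box, zero_add]
  refine and_congr ⟨fun ⟨f, hf⟩ => ⟨_, hf⟩, fun ⟨f, hf⟩ => ⟨f + z, by simpa using hf⟩⟩ ?_
  constructor
  · intro h u hu
    have := h (u + z) ((hb _).2 (by simpa using hu))
    simpa using this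
  · intro h u hu
    exact h _ ((hb u).1 hu)

theorem ValueLaw.real_missed (hν : ValueLaw ν) (z : Site) (m : ℕ) :
    ν.real {v | Missed v z m} = ν.real {v | Missed v 0 m} := by
  rw [measureReal_def, measureReal_def,
    ← (hν.inv z).measure_preimage (measurableSet_missed z m).nullMeasurableSet]
  congr 2
  ext v
  exact missed_shift z v m

theorem exists_real_missed_le [IsFiniteMeasure ν] {ε : ℝ} (hε : 0 < ε) :
    ∃ n₀ : ℕ, ∀ m ≥ n₀, ν.real {v | Missed v 0 m} ≤ ε := by
  have h1 : Filter.Tendsto (fun m : ℕ => ν {v | Missed v 0 m}) Filter.atTop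
      (nhds (ν (⋂ m : ℕ, {v | Missed v 0 m}))) := by
    refine tendsto_measure_iInter_atTop
      (fun m => (measurableSet_missed 0 m).nullMeasurableSet) ?_ ⟨0, measure_ne_top _ _⟩
    intro m m' hmm v hv
    refine ⟨hv.1, fun u hu => hv.2 u ?_⟩
    simp only [mem_box] at hu ⊢; omega
  have h2 : (⋂ m : ℕ, {v : Edge → ℝ | Missed v 0 m}) = ∅ := by
    rw [Set.eq_empty_iff_forall_notMem]
    intro v hv
    rw [Set.mem_iInter] at hv
    obtain ⟨f, hf⟩ := (hv 0).1
    obtain ⟨r, hr⟩ := exists_box_of_finset {f}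
    exact (hv r).2 f (hr (by simp)) hf
  rw [h2, measure_empty] at h1
  have h3 := (ENNReal.tendsto_toReal ENNReal.zero_ne_top).comp h1
  rw [ENNReal.toReal_zero] at h3
  exact Filter.eventually_atTop.1 (h3.eventually_le_const hε)

/-- Almost surely all components are finite. On a ring of radius `≈ λ m` there are `≈ λ` blocks of
radius `m`. Each of them is badly enclosed with probability of order `λ⁻²`, and the other failure
probabilities vanish as `m` tends to infinity. -/
theorem ValueLaw.ae_forall_not_infComp [IsProbabilityMeasure ν] (hν : ValueLaw ν) :
    ∀ᵐ v ∂ν, ∀ f, ¬ InfComp v f := by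
  set J : Set (Edge → ℝ) := {v | ∃ f, InfComp v f} with hJ
  suffices h : ν.real J = 0 by
    rw [measureReal_eq_zero_iff] at h
    filter_upwards [measure_eq_zero_iff_ae_notMem.1 h] with v hv f hf
    exact hv ⟨f, hf⟩
  by_contra hne
  set a := ν.real J with ha
  have ha0 : 0 < a := lt_of_le_of_ne measureReal_nonneg (Ne.symm hne)
  obtain ⟨M, hM, hlarge⟩ := hν.large (1 / 64) (by norm_num)
  obtain ⟨c, hc, hweight⟩ := hν.exists_weight
  obtain ⟨b, hb⟩ := exists_nat_ge (400 * (448 * M / c) ^ 2 / a)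
  set lam := max b 1 with hlam
  have hlam1 : 1 ≤ lam := le_max_right _ _
  have hlamR : (1 : ℝ) ≤ lam := by exact_mod_cast hlam1
  set ε := a / (800 * lam) with hε
  have hε0 : 0 < ε := by positivity
  obtain ⟨n₁, hn₁⟩ := exists_real_missed_le (ν := ν) hε0
  obtain ⟨n₂, hn₂⟩ := exists_pow_le (r := 1 / 4) (by norm_num) (by norm_num) 4 hε0
  obtain ⟨n₃, hn₃⟩ : ∃ n₃ : ℕ, ∀ n ≥ n₃, 441 * ((n : ℝ) ^ 2 * (1 / 2 : ℝ) ^ n) ≤ ε := by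
    have h := (tendsto_pow_const_mul_const_pow_of_abs_lt_one 2
      (r := (1 / 2 : ℝ)) (by rw [abs_of_pos] <;> norm_num)).const_mul 441
    rw [mul_zero] at h
    exact Filter.eventually_atTop.1 (h.eventually_le_const hε0)
  set m := max (max n₁ n₂) (max n₃ 1) with hm
  have hm1 : 1 ≤ m := (le_max_right _ _).trans (le_max_right _ _)
  have hmR : (1 : ℝ) ≤ m := by exact_mod_cast hm1
  set Λ := 4 * lam + 8 with hΛ
  set k := lam * m with hk
  have hmk : m ≤ k := Nat.le_mul_of_pos_left _ hlam1
  set s : ℝ := c * lam / 4 with hs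
  have hs0 : 0 < s := by positivity
  -- The bad events at the centre `z`.
  set B : Site → Set (Edge → ℝ) := fun z => {v | Missed v z m} ∪ ({v | ¬ Enclosed v z (3 * m) s} ∪
    {v | ¬ ∀ f ∈ box z (6 * m + 2 * k + 2), ∀ l ∈ pathLists dualMove (2 * k) f, l.Nodup →
      c * k ≤ ∑ e ∈ l.toFinset, |v e|}) with hB
  have hBr : ∀ z, ν.real (B z) ≤ (448 * M / c) ^ 2 / lam ^ 2 + 3 * ε := by
    intro z
    have h1 : ν.real {v | Missed v z m} ≤ ε := by
      rw [hν.real_missed]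
      exact hn₁ m ((le_max_left _ _).trans (le_max_left _ _))
    have h2 : ν.real {v | ¬ Enclosed v z (3 * m) s} ≤ (448 * M / c) ^ 2 / lam ^ 2 + ε := by
      refine (real_not_enclosed_le hM hlarge (by omega) hs0 z).trans (add_le_add ?_ ?_)
      · refine le_of_eq ?_
        rw [← div_pow, hs]
        congr 1
        field_simp
        norm_num
      · refine (sq_mul_pow_le _).trans (hn₂ _ ?_)
        have : n₂ ≤ m := (le_max_right _ _).trans (le_max_left _ _)
        omega
    have h3 : ν.real {v | ¬ ∀ f ∈ box z (6 * m + 2 * k + 2), ∀ l ∈ pathLists dualMove (2 * k) f,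
        l.Nodup → c * k ≤ ∑ e ∈ l.toFinset, |v e|} ≤ ε := by
      refine (hweight z _ k).trans (le_trans ?_ (hn₃ k ?_))
      · have h4 : (2 * ((6 * m + 2 * k + 2 : ℕ) : ℝ) + 1) ≤ 21 * k := by
          have : (m : ℝ) ≤ k := by exact_mod_cast hmk
          push_cast
          linarith
        calc _ ≤ (21 * (k : ℝ)) ^ 2 * (1 / 2) ^ k := by gcongr
          _ = _ := by ring
      · exact ((le_max_left _ _).trans (le_max_right _ _)).trans hmk
    have h4 := measureReal_union_le (μ := ν) {v | Missed v z m} ({v | ¬ Enclosed v z (3 * m) s} ∪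
      {v | ¬ ∀ f ∈ box z (6 * m + 2 * k + 2), ∀ l ∈ pathLists dualMove (2 * k) f, l.Nodup →
        c * k ≤ ∑ e ∈ l.toFinset, |v e|})
    have h5 := measureReal_union_le (μ := ν) {v | ¬ Enclosed v z (3 * m) s}
      {v | ¬ ∀ f ∈ box z (6 * m + 2 * k + 2), ∀ l ∈ pathLists dualMove (2 * k) f, l.Nodup →
        c * k ≤ ∑ e ∈ l.toFinset, |v e|}
    have h6 : ν.real (B z) ≤ _ := h4
    linarith
  have hae : J ≤ᵐ[ν] ⋃ z ∈ ring Λ m, B z := by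
    filter_upwards [hν.cut, hν.ae_reachable] with v hv huniq hvJ
    by_contra hcon
    change v ∉ (⋃ z ∈ ring Λ m, B z : Set (Edge → ℝ)) at hcon
    simp only [Set.mem_iUnion, hB, Set.mem_union, Set.mem_ofPred_eq, not_exists, not_or,
      not_not] at hcon
    refine hv.false_of_ring huniq (Λ := Λ) (m := m) (k := 2 * k) (w := c * k) (s := s) hm1 ?_ ?_
      (fun z hz => ?_) (fun z hz => (hcon z hz).2.1) (fun z hz => (hcon z hz).2.2)
    · have h1 : 4 * k + 8 * m = Λ * m := by rw [hΛ, hk]; ring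
      omega
    · rw [hs, hk]
      push_cast
      have : 0 < c * lam * m := by positivity
      linarith
    · have h1 := (hcon z hz).1
      by_contra h2
      push Not at h2
      exact h1 ⟨hvJ, h2⟩
  have h1 : a ≤ ∑ z ∈ ring Λ m, ν.real (B z) := by
    have h2 : ν.real J ≤ ν.real (⋃ z ∈ ring Λ m, B z) :=
      ENNReal.toReal_mono (measure_ne_top _ _) (measure_mono_ae hae)
    exact h2.trans (measureReal_biUnion_finset_le _ _)
  have hcard : ((ring Λ m).card : ℝ) ≤ 100 * lam := by
    have h2 : (ring Λ m).card ≤ 100 * lam := (card_ring_le Λ m).trans (by omega)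
    exact_mod_cast h2
  have h2 : a ≤ 100 * lam * ((448 * M / c) ^ 2 / lam ^ 2 + 3 * ε) := by
    refine h1.trans ((Finset.sum_le_sum fun z _ => hBr z).trans ?_)
    rw [Finset.sum_const, nsmul_eq_mul]
    gcongr
  have h3 : 100 * (lam : ℝ) * (3 * ε) = 3 / 8 * a := by
    rw [hε]; field_simp; norm_num
  have h4 : 100 * (lam : ℝ) * ((448 * M / c) ^ 2 / lam ^ 2) ≤ a / 4 := by
    have h5 : 400 * (448 * M / c) ^ 2 / a ≤ lam := hb.trans (by exact_mod_cast le_max_left _ _)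
    rw [div_le_iff₀ ha0] at h5
    have h6 : 100 * (lam : ℝ) * ((448 * M / c) ^ 2 / lam ^ 2) = 100 * (448 * M / c) ^ 2 / lam := by
      field_simp
    rw [h6, div_le_iff₀ (by positivity)]
    linarith
  linarith

/-! ### The law of the edge values -/

theorem abs_pairValue (J : Coupling) (p : SpinPair) (e : Edge) : |pairValue J p e| = |J e| := by
  induction p using Quotient.inductionOn with
  | h σ =>
    have h : ∀ u : ℤˣ, |((u : ℤ) : ℝ)| = 1 := fun u => by
      rcases Int.units_eq_one_or u with rfl | rfl <;> simp
    simp [pairValue, edgeValue, abs_mul, h]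

theorem pairValue_translate (z : Site) (x : Coupling × SpinPair) :
    pairValue (translateJoint z x).1 (translateJoint z x).2 = shift z (pairValue x.1 x.2) := by
  obtain ⟨J, p⟩ := x
  induction p using Quotient.inductionOn with
  | h σ =>
    ext e
    simp only [pairValue, translateJoint, translatePair, Quotient.map_mk, Quotient.lift_mk, shift,
      edgeValue, translateCoupling, translateSpin, Edge.src, Edge.tgt, add_sub_right_comm]

theorem measurable_pairValue :
    Measurable fun x : Coupling × SpinPair => (pairValue x.1 x.2 : Edge → ℝ) := by
  refine measurable_pi_iff.2 fun e => ?_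
  -- The value is the product of the coupling and a function of the pair.
  let S : SpinPair → ℝ := fun p => pairValue (fun _ => 1) p e
  have hS : Measurable S := by
    refine measurable_from_quotient.2 ?_
    have h : ∀ y : Site, Measurable fun σ : Spin => (((σ y : ℤˣ) : ℤ) : ℝ) := fun y =>
      (measurable_from_top (f := fun n : ℤ => (n : ℝ))).comp
        ((comap_measurable (Units.val : ℤˣ → ℤ)).comp (measurable_pi_apply y))
    change Measurable fun σ : Spin => edgeValue (fun _ => 1) σ e
    unfold edgeValue
    exact (measurable_const.mul (h _)).mul (h _)
  have h : (fun x : Coupling × SpinPair => pairValue x.1 x.2 e) = fun x => x.1 e * S x.2 := by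
    ext ⟨J, p⟩
    induction p using Quotient.inductionOn with
    | h σ => simp only [S, pairValue, Quotient.lift_mk, edgeValue]; ring
  rw [h]
  exact ((measurable_pi_apply e).comp measurable_fst).mul (hS.comp measurable_snd)

theorem measurable_shift (z : Site) : Measurable (shift z) :=
  measurable_pi_iff.2 fun _ => measurable_pi_apply _

theorem measurableSet_cutNonneg : MeasurableSet {v | CutNonneg v} := by
  have h : {v | CutNonneg v} = ⋂ C : Finset Site, {v | 0 ≤ ∑ e ∈ edgeBoundary C, v e} := by
    ext v; simp only [CutNonneg, Set.mem_iInter, Set.mem_ofPred_eq]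
  rw [h]
  exact MeasurableSet.iInter fun C =>
    measurableSet_le measurable_const (Finset.measurable_sum _ fun e _ => measurable_pi_apply e)

theorem exists_real_abs_gt_le (ρ : Measure ℝ) [IsProbabilityMeasure ρ] {ε : ℝ} (hε : 0 < ε) :
    ∃ M > 0, ρ.real {t | |t| ∈ Set.Ioi M} ≤ ε := by
  have h1 : Filter.Tendsto (fun n : ℕ => ρ {t | |t| ∈ Set.Ioi (n : ℝ)}) Filter.atTop
      (nhds (ρ (⋂ n : ℕ, {t | |t| ∈ Set.Ioi (n : ℝ)}))) := by
    refine tendsto_measure_iInter_atTop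
      (fun n => (measurable_id.abs measurableSet_Ioi).nullMeasurableSet) ?_
      ⟨0, measure_ne_top _ _⟩
    intro n n' hn t ht
    exact lt_of_le_of_lt (Nat.cast_le.2 hn) (show (n' : ℝ) < |t| from ht)
  have h2 : (⋂ n : ℕ, {t : ℝ | |t| ∈ Set.Ioi (n : ℝ)}) = ∅ := by
    rw [Set.eq_empty_iff_forall_notMem]
    intro t ht
    obtain ⟨n, hn⟩ := exists_nat_ge |t|
    exact absurd (Set.mem_iInter.1 ht n) (not_lt.2 hn)
  rw [h2, measure_empty] at h1
  have h3 := (ENNReal.tendsto_toReal ENNReal.zero_ne_top).comp h1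
  rw [ENNReal.toReal_zero] at h3
  obtain ⟨n, hn⟩ := ((h3.eventually_le_const hε).and (Filter.eventually_gt_atTop 0)).exists
  exact ⟨n, by exact_mod_cast hn.2, hn.1⟩

theorem exists_real_abs_le_le (ρ : Measure ℝ) [IsProbabilityMeasure ρ] (h0 : ρ {0} = 0) {ε : ℝ}
    (hε : 0 < ε) : ∃ c > 0, ρ.real {t | |t| ∈ Set.Iic c} ≤ ε := by
  have h1 : Filter.Tendsto (fun n : ℕ => ρ {t | |t| ∈ Set.Iic (1 / ((n : ℝ) + 1))}) Filter.atTop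
      (nhds (ρ (⋂ n : ℕ, {t | |t| ∈ Set.Iic (1 / ((n : ℝ) + 1))}))) := by
    refine tendsto_measure_iInter_atTop
      (fun n => (measurable_id.abs measurableSet_Iic).nullMeasurableSet) ?_
      ⟨0, measure_ne_top _ _⟩
    intro n n' hn t ht
    exact (show |t| ≤ 1 / ((n' : ℝ) + 1) from ht).trans (one_div_le_one_div_of_le (by positivity)
      (by simpa using hn))
  have h2 : (⋂ n : ℕ, {t : ℝ | |t| ∈ Set.Iic (1 / ((n : ℝ) + 1))}) ⊆ {0} := by
    intro t ht
    by_contra hne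
    obtain ⟨n, hn⟩ := exists_nat_one_div_lt (abs_pos.2 hne)
    exact absurd (Set.mem_iInter.1 ht n) (not_le.2 hn)
  rw [measure_mono_null h2 h0] at h1
  have h3 := (ENNReal.tendsto_toReal ENNReal.zero_ne_top).comp h1
  rw [ENNReal.toReal_zero] at h3
  obtain ⟨n, hn⟩ := (h3.eventually_le_const hε).exists
  exact ⟨1 / ((n : ℝ) + 1), by positivity, hn⟩

theorem valueLaw_map (ρ : Measure ℝ) [IsProbabilityMeasure ρ] (h0 : ρ {0} = 0)
    (μ : Measure (Coupling × SpinPair)) [IsProbabilityMeasure μ]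
    (hcoupling : μ.map Prod.fst = Measure.infinitePi (fun _ : Edge => ρ))
    (hinv : ∀ z : Site, MeasurePreserving (translateJoint z) μ μ)
    (hground : ∀ᵐ x ∂μ, IsGroundStatePair x.1 x.2) :
    ValueLaw (μ.map fun x => (pairValue x.1 x.2 : Edge → ℝ)) := by
  have hiid : ∀ (B : Set ℝ), MeasurableSet B → ∀ s : Finset Edge,
      (μ.map fun x => (pairValue x.1 x.2 : Edge → ℝ)).real {v | ∀ e ∈ s, |v e| ∈ B}
        = ρ.real {t | |t| ∈ B} ^ s.card := by
    intro B hB s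
    have hm : MeasurableSet {v : Edge → ℝ | ∀ e ∈ s, |v e| ∈ B} := by
      have : {v : Edge → ℝ | ∀ e ∈ s, |v e| ∈ B} = ⋂ e ∈ s, {v | |v e| ∈ B} := by
        ext v; simp only [Set.mem_iInter, Set.mem_ofPred_eq]
      rw [this]
      exact Finset.measurableSet_biInter _ fun e _ => (measurable_pi_apply e).abs hB
    have h1 : (μ.map fun x => (pairValue x.1 x.2 : Edge → ℝ)) {v | ∀ e ∈ s, |v e| ∈ B}
        = (μ.map Prod.fst) {v : Edge → ℝ | ∀ e ∈ s, |v e| ∈ B} := by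
      rw [Measure.map_apply measurable_pairValue hm, Measure.map_apply measurable_fst hm]
      congr 1
      ext x
      simp only [Set.mem_preimage, Set.mem_ofPred_eq, abs_pairValue]
    have h2 : {v : Edge → ℝ | ∀ e ∈ s, |v e| ∈ B} = Set.pi s fun _ => {t | |t| ∈ B} := by
      ext v; simp only [Set.mem_pi, Set.mem_ofPred_eq, Finset.mem_coe]
    have hBm : MeasurableSet {t : ℝ | |t| ∈ B} := measurable_id.abs hB
    rw [measureReal_def, h1, hcoupling, h2, Measure.infinitePi_pi _ (fun _ _ => hBm), Finset.prod_const,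
      ENNReal.toReal_pow, measureReal_def]
  refine ⟨fun z => ⟨measurable_shift z, ?_⟩, ?_, fun ε hε => ?_, fun ε hε => ?_⟩
  · rw [Measure.map_map (measurable_shift z) measurable_pairValue]
    have h : shift z ∘ (fun x : Coupling × SpinPair => (pairValue x.1 x.2 : Edge → ℝ))
        = (fun x => (pairValue x.1 x.2 : Edge → ℝ)) ∘ translateJoint z := by
      ext x : 1
      exact (pairValue_translate z x).symm
    rw [h, ← Measure.map_map measurable_pairValue (hinv z).measurable, (hinv z).map_eq]
  · rw [ae_map_iff measurable_pairValue.aemeasurable measurableSet_cutNonneg]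
    filter_upwards [hground] with x hx
    obtain ⟨J, p⟩ := x
    induction p using Quotient.inductionOn with
    | h σ => exact hx σ rfl
  · obtain ⟨M, hM, h⟩ := exists_real_abs_gt_le ρ hε
    refine ⟨M, hM, fun s => ?_⟩
    rw [hiid _ measurableSet_Ioi]
    gcongr
  · obtain ⟨c, hc, h⟩ := exists_real_abs_le_le ρ h0 hε
    refine ⟨c, hc, fun s => ?_⟩
    rw [hiid _ measurableSet_Iic]
    gcongr

end SpinGlass

theorem mainTheorem1
    (ρ : MeasureTheory.Measure ℝ) [MeasureTheory.IsProbabilityMeasure ρ]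
    (hcont : ∀ t : ℝ, ρ {t} = 0)
    (hsymm : ρ.map (fun t : ℝ => -t) = ρ)
    (hsupp : ρ.support = Set.univ)
    (μ : MeasureTheory.Measure (SpinGlass.Coupling × SpinGlass.SpinPair))
    [MeasureTheory.IsProbabilityMeasure μ]
    (hcoupling : μ.map Prod.fst =
      MeasureTheory.Measure.infinitePi (fun _ : SpinGlass.Edge => ρ))
    (hinv : ∀ z : SpinGlass.Site,
      MeasureTheory.MeasurePreserving (SpinGlass.translateJoint z) μ μ)
    (hground : ∀ᵐ x ∂μ, SpinGlass.IsGroundStatePair x.1 x.2) :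
    ∀ᵐ x ∂μ, (SpinGlass.unsatDual x.1 x.2).IsAcyclic ∧
      ∀ c : (SpinGlass.unsatDual x.1 x.2).ConnectedComponent, c.supp.Finite := by
  have hν := SpinGlass.valueLaw_map ρ (hcont 0) μ hcoupling hinv hground
  have hm := SpinGlass.measurable_pairValue.aemeasurable (μ := μ)
  have := MeasureTheory.Measure.isProbabilityMeasure_map hm
  filter_upwards [MeasureTheory.ae_of_ae_map hm hν.cut,
    MeasureTheory.ae_of_ae_map hm hν.ae_forall_not_infComp] with x hx1 hx2
  refine ⟨hx1.isAcyclic, fun c => ?_⟩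
  induction c using SimpleGraph.ConnectedComponent.ind with
  | _ f =>
    refine (Set.not_infinite.1 (hx2 f)).subset fun g hg => ?_
    exact (SimpleGraph.ConnectedComponent.exact hg).symm
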